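/- **Definitions.** A geometric realization of a simple graph $G$ is a straight-line drawing of $G$ in the plane with vertices in general position (distinct vertices at distinct points, no three vertices collinear, no three edges crossing at a single point). Two edges cross if their segments have a common interior point. For geometric realizations $\overline G,\widehat G$ of the same finite graph $G$, a geometric isomorphism is a bijection $f$ of the vertices such that $uv$ is an edge if and only if $f(u)f(v)$ is an edge, and $xy$ crosses $uv$ in $\overline G$ if and only if $f(x)f(y)$ crosses $f(u)f(v)$ in $\widehat G$. Write $\overline G\preceq\widehat G$ if there is an injective vertex map $\overline G\to\widehat G$ that preserves adjacencies and crossings. The relation $\preceq$ induces a partial order on the set of geometric isomorphism classes of realizations of $G$. Let $\mathcal C_n$ be this poset for the cycle $C_n$ with vertices $1,\dots,n$ and edges $e_i=\{i,i+1\}$ for $1\le i<n$ and $e_n=\{n,1\}$. A class is described below by the set of all crossings $e_i\times e_j$ of one of its realizations. **Theorem.** 1. $\mathcal C_3$ is trivial, containing only the class of the plane realization (no crossings). 2. $\mathcal C_4$ is a chain of two elements: $\emptyset\prec\{e_1\times e_3\}$. 3. $\mathcal C_5$ is a chain of five elements, in increasing order: $0.1=\emptyset$; $1.1=\{e_1\times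 e_3\}$; $2.1=\{e_1\times e_3, e_1\times e_4\}$; $3.1=\{e_1\times e_3, e_1\times e_4, e_2\times e_4\}$; $5.1=\{e_1\times e_3, e_1\times e_4, e_2\times e_4, e_2\times e_5, e_3\times e_5\}$. 4. $\mathcal C_6$ has exactly the following twenty-six elements, which are pairwise distinct: 0 crossings: $0.1=\emptyset$. 1 crossing: $1.1=\{e_1\times e_3\}$, $1.2=\{e_1\times e_4\}$. 2 crossings: $2.1=\{e_1\times e_3,e_1\times e_4\}$, $2.2=\{e_1\times e_3,e_1\times e_5\}$, $2.3=\{e_1\times e_3,e_4\times e_6\}$. 3 crossings: $3.1=\{e_1\times e_3,e_1\times e_4,e_1\times e_5\}$, $3.2=\{e_1\times e_3,e_1\times e_4,e_2\times e_4\}$, $3.3=\{e_1\times e_3,e_1\times e_4,e_2\times e_5\}$, $3.4=\{e_1\times e_3,e_1\times e_4,e_3\times e_5\}$, $3.5=\{e_1\times e_3,e_1\times e_4,e_3\times e_6\}$, $3.6=\{e_1\times e_3,e_1\times e_4,e_4\times e_6\}$, $3.7=\{e_1\times e_3,e_1\times e_5,e_3\times e_5\}$, $3.8=\{e_1\times e_4,e_2\times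 e_5,e_3\times e_6\}$. 4 crossings: $4.1=\{e_1\times e_3,e_1\times e_4,e_1\times e_5,e_2\times e_4\}$, $4.2=\{e_1\times e_3,e_1\times e_4,e_1\times e_5,e_2\times e_5\}$, $4.3=\{e_1\times e_3,e_1\times e_4,e_1\times e_5,e_3\times e_5\}$, $4.4=\{e_1\times e_3,e_1\times e_4,e_2\times e_5,e_3\times e_5\}$, $4.5=\{e_1\times e_3,e_1\times e_4,e_3\times e_6,e_4\times e_6\}$. 5 crossings: $5.1=\{e_1\times e_3,e_1\times e_4,e_1\times e_5,e_2\times e_4,e_2\times e_5\}$, $5.2=\{e_1\times e_3,e_1\times e_4,e_2\times e_4,e_2\times e_5,e_3\times e_5\}$, $5.3=\{e_1\times e_3,e_1\times e_4,e_2\times e_4,e_2\times e_5,e_3\times e_6\}$, $5.4=\{e_1\times e_3,e_1\times e_4,e_2\times e_5,e_3\times e_6,e_4\times e_6\}$. 6 crossings: $6.1=\{e_1\times e_3,e_1\times e_4,e_1\times e_5,e_2\times e_4,e_2\times e_5,e_3\times e_5\}$, $6.2=\{e_1\times e_3,e_1\times e_4,e_1\times e_5,e_2\times e_4,e_2\times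 e_5,e_3\times e_6\}$. 7 crossings: $7.1=\{e_1\times e_3,e_1\times e_4,e_1\times e_5,e_2\times e_4,e_2\times e_5,e_3\times e_6,e_4\times e_6\}$. Its Hasse diagram consists of exactly the following 52 covering relations (each element is followed by all the elements that cover it): $0.1$: $1.1, 1.2$; $1.1$: $2.1, 2.2, 2.3$; $1.2$: $2.1, 3.8$; $2.1$: $3.1, 3.2, 3.3, 3.4, 3.5, 3.6$; $2.2$: $3.1, 3.4, 3.7$; $2.3$: $3.6$; $3.1$: $4.1, 4.2, 4.3$; $3.2$: $4.1, 5.2, 5.3$; $3.3$: $4.2, 4.4, 5.3, 5.4$; $3.4$: $4.2, 4.3, 4.4$; $3.5$: $4.2, 4.5, 5.2, 5.3$; $3.6$: $4.1, 4.5$; $3.7$: $4.3$; $3.8$: $5.3, 5.4$; $4.1$: $5.1$; $4.2$: $5.1$; $4.3$: $6.1$; $4.4$: $5.2, 6.2$; $4.5$: $5.1, 5.4$; $5.1$: $6.1, 6.2$; $5.2$: $6.1$; $5.3$: $6.2$; $5.4$: $6.2$; $6.2$: $7.1$; $6.1$ and $7.1$: none (both are maximal). -/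

import Mathlib

/-- A geometric realization of a simple graph `G` is a straight-line drawing of `G` in the plane
with vertices in general position: distinct vertices are distinct points, no three vertices are
collinear, and no three edges cross at a single point. -/
structure GeometricRealization {V : Type} (G : SimpleGraph V) where
  /-- The point of the plane at which a vertex is placed. -/
  pos : V → ℝ × ℝ
  pos_injective : Function.Injective pos
  not_collinear : ∀ u v w : V, u ≠ v → u ≠ w → v ≠ w →
    ¬ Collinear ℝ ({pos u, pos v, pos w} : Set (ℝ × ℝ))
  /-- No three distinct edges pass through a common interior point. (Edges that merely share an
  endpoint do not cross there, hence open segments.) -/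
  not_concurrent : ∀ u₁ v₁ u₂ v₂ u₃ v₃ : V, G.Adj u₁ v₁ → G.Adj u₂ v₂ → G.Adj u₃ v₃ →
    s(u₁, v₁) ≠ s(u₂, v₂) → s(u₁, v₁) ≠ s(u₃, v₃) → s(u₂, v₂) ≠ s(u₃, v₃) →
    openSegment ℝ (pos u₁) (pos v₁) ∩ openSegment ℝ (pos u₂) (pos v₂)
      ∩ openSegment ℝ (pos u₃) (pos v₃) = ∅

namespace GeometricRealization

/-- `A.Cross u v x y`: `uv` and `xy` are two distinct edges of the realization `A` that cross,
that is, the segments that draw them have a common interior point. -/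
def Cross {V : Type} {G : SimpleGraph V} (A : GeometricRealization G) (u v x y : V) : Prop :=
  G.Adj u v ∧ G.Adj x y ∧ s(u, v) ≠ s(x, y) ∧
    (openSegment ℝ (A.pos u) (A.pos v) ∩ openSegment ℝ (A.pos x) (A.pos y)).Nonempty

/-- The set of crossings of a realization: all unordered pairs of edges that cross. -/
def crossings {V : Type} {G : SimpleGraph V} (A : GeometricRealization G) :
    Set (Sym2 (Sym2 V)) :=
  {c | ∃ u v x y : V, A.Cross u v x y ∧ c = s(s(u, v), s(x, y))}

/-- A geometric homomorphism is a vertex map that preserves adjacencies and crossings. -/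
structure IsHom {V W : Type} {G : SimpleGraph V} {H : SimpleGraph W}
    (A : GeometricRealization G) (B : GeometricRealization H) (f : V → W) : Prop where
  map_adj : ∀ u v : V, G.Adj u v → H.Adj (f u) (f v)
  map_cross : ∀ u v x y : V, A.Cross x y u v → B.Cross (f x) (f y) (f u) (f v)

/-- A geometric isomorphism is a bijection between the vertices that preserves and reflects
adjacencies and crossings. -/
structure IsIso {V W : Type} {G : SimpleGraph V} {H : SimpleGraph W}
    (A : GeometricRealization G) (B : GeometricRealization H) (f : V → W) : Prop where
  bijective : Function.Bijective f
  adj_iff : ∀ u v : V, G.Adj u v ↔ H.Adj (f u) (f v)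
  cross_iff : ∀ u v x y : V, A.Cross x y u v ↔ B.Cross (f x) (f y) (f u) (f v)

/-- `A ⪯ B`: there is a vertex-injective geometric homomorphism from `A` to `B`. -/
def Precedes {V : Type} {G : SimpleGraph V} (A B : GeometricRealization G) : Prop :=
  ∃ f : V → V, Function.Injective f ∧ IsHom A B f

/-- `A ≅ B`: there is a geometric isomorphism from `A` to `B`. -/
def Isomorphic {V : Type} {G : SimpleGraph V} (A B : GeometricRealization G) : Prop :=
  ∃ f : V → V, IsIso A B f

theorem Precedes.refl {V : Type} {G : SimpleGraph V} (A : GeometricRealization G) :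
    A.Precedes A :=
  ⟨id, Function.injective_id, ⟨fun _ _ h => h, fun _ _ _ _ h => h⟩⟩

theorem IsHom.comp {V : Type} {G : SimpleGraph V} {A B C : GeometricRealization G} {f g : V → V}
    (hg : IsHom B C g) (hf : IsHom A B f) : IsHom A C (g ∘ f) :=
  ⟨fun u v h => hg.map_adj _ _ (hf.map_adj u v h),
    fun u v x y h => hg.map_cross _ _ _ _ (hf.map_cross u v x y h)⟩

theorem Precedes.trans {V : Type} {G : SimpleGraph V} {A B C : GeometricRealization G}
    (h₁ : A.Precedes B) (h₂ : B.Precedes C) : A.Precedes C := by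
  obtain ⟨f, hfi, hf⟩ := h₁
  obtain ⟨g, hgi, hg⟩ := h₂
  exact ⟨g ∘ f, hgi.comp hfi, hg.comp hf⟩

theorem Isomorphic.refl {V : Type} {G : SimpleGraph V} (A : GeometricRealization G) :
    A.Isomorphic A :=
  ⟨id, Function.bijective_id, fun _ _ => Iff.rfl, fun _ _ _ _ => Iff.rfl⟩

theorem Isomorphic.symm {V : Type} {G : SimpleGraph V} {A B : GeometricRealization G}
    (h : A.Isomorphic B) : B.Isomorphic A := by
  obtain ⟨f, hb, ha, hc⟩ := h
  have hr : ∀ u, f ((Equiv.ofBijective f hb).symm u) = u :=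
    fun u => (Equiv.ofBijective f hb).apply_symm_apply u
  refine ⟨(Equiv.ofBijective f hb).symm, (Equiv.ofBijective f hb).symm.bijective,
    fun u v => ?_, fun u v x y => ?_⟩
  · rw [ha ((Equiv.ofBijective f hb).symm u), hr, hr]
  · rw [hc, hr, hr, hr, hr]

theorem Isomorphic.trans {V : Type} {G : SimpleGraph V} {A B C : GeometricRealization G}
    (h₁ : A.Isomorphic B) (h₂ : B.Isomorphic C) : A.Isomorphic C := by
  obtain ⟨f, hf⟩ := h₁
  obtain ⟨g, hg⟩ := h₂
  exact ⟨g ∘ f, hg.bijective.comp hf.bijective,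
    fun u v => (hf.adj_iff u v).trans (hg.adj_iff _ _),
    fun u v x y => (hf.cross_iff u v x y).trans (hg.cross_iff _ _ _ _)⟩

theorem Isomorphic.precedes {V : Type} {G : SimpleGraph V} {A B : GeometricRealization G}
    (h : A.Isomorphic B) : A.Precedes B := by
  obtain ⟨f, hf⟩ := h
  exact ⟨f, hf.bijective.injective, fun u v => (hf.adj_iff u v).1,
    fun u v x y => (hf.cross_iff u v x y).1⟩

theorem Precedes.antisymm {V : Type} [Finite V] {G : SimpleGraph V}
    {A B : GeometricRealization G} (h₁ : A.Precedes B) (h₂ : B.Precedes A) :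
    A.Isomorphic B := by
  obtain ⟨f, hfi, hf⟩ := h₁
  obtain ⟨g, hgi, hg⟩ := h₂
  have hb : Function.Bijective (g ∘ f) := Finite.injective_iff_bijective.1 (hgi.comp hfi)
  have hfb : Function.Bijective f := Finite.injective_iff_bijective.1 hfi
  have hit : ∀ k : ℕ, IsHom A A ((g ∘ f)^[k]) := by
    intro k
    induction k with
    | zero => exact ⟨fun _ _ h => h, fun _ _ _ _ h => h⟩
    | succ k ih => rw [Function.iterate_succ]; exact ih.comp (hg.comp hf)
  obtain ⟨k, hk⟩ : ∃ k : ℕ, (g ∘ f)^[k + 1] = id := by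
    let σ : Equiv.Perm V := Equiv.ofBijective _ hb
    have hσ : ∀ n : ℕ, ((σ ^ n : Equiv.Perm V) : V → V) = (g ∘ f)^[n] := fun n =>
      Equiv.Perm.iterate_eq_pow σ n ▸ rfl
    obtain ⟨n, hn, h1⟩ := (isOfFinOrder_of_finite σ).exists_pow_eq_one
    refine ⟨n - 1, ?_⟩
    rw [Nat.sub_add_cancel hn, ← hσ, h1]
    rfl
  have hinv : IsHom B A ((g ∘ f)^[k] ∘ g) := (hit k).comp hg
  have hl : ∀ u, ((g ∘ f)^[k] ∘ g) (f u) = u := by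
    intro u
    have := congrFun hk u
    rwa [Function.iterate_succ] at this
  refine ⟨f, hfb, fun u v => ⟨hf.map_adj u v, fun h => ?_⟩,
    fun u v x y => ⟨hf.map_cross u v x y, fun h => ?_⟩⟩
  · have := hinv.map_adj _ _ h
    rwa [hl, hl] at this
  · have := hinv.map_cross _ _ _ _ h
    rwa [hl, hl, hl, hl] at this

/-- Geometric isomorphism as an equivalence relation on the realizations of `G`. -/
def setoid {V : Type} (G : SimpleGraph V) : Setoid (GeometricRealization G) where
  r := Isomorphic
  iseqv := ⟨Isomorphic.refl, Isomorphic.symm, Isomorphic.trans⟩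

end GeometricRealization

/-- The geometric homomorphism poset of `G`: the geometric isomorphism classes of its
realizations. -/
def GeometricPoset {V : Type} (G : SimpleGraph V) : Type :=
  Quotient (GeometricRealization.setoid G)

/-- The isomorphism class of a geometric realization. -/
def GeometricRealization.toClass {V : Type} {G : SimpleGraph V} (A : GeometricRealization G) :
    GeometricPoset G :=
  Quotient.mk (GeometricRealization.setoid G) A

/-- The order on isomorphism classes that is induced by `A ⪯ B`. -/
instance GeometricPoset.instPartialOrder {V : Type} [Finite V] (G : SimpleGraph V) :
    PartialOrder (GeometricPoset G) where
  le := Quotient.lift₂ GeometricRealization.Precedes (by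
    intro A B A' B' hA hB
    exact propext
      ⟨fun h => (GeometricRealization.Isomorphic.precedes
          (GeometricRealization.Isomorphic.symm hA)).trans (h.trans hB.precedes),
       fun h => hA.precedes.trans (h.trans (GeometricRealization.Isomorphic.precedes
          (GeometricRealization.Isomorphic.symm hB)))⟩)
  le_refl X := by
    induction X using Quotient.inductionOn
    exact GeometricRealization.Precedes.refl _
  le_trans X Y Z := by
    induction X using Quotient.inductionOn
    induction Y using Quotient.inductionOn
    induction Z using Quotient.inductionOn
    exact fun h₁ h₂ => GeometricRealization.Precedes.trans h₁ h₂
  le_antisymm X Y := by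
    induction X using Quotient.inductionOn
    induction Y using Quotient.inductionOn
    exact fun h₁ h₂ => Quotient.sound (s := GeometricRealization.setoid G)
      (GeometricRealization.Precedes.antisymm h₁ h₂)

/-- The order of classes is the relation `⪯` between their representatives. -/
theorem GeometricRealization.toClass_le_toClass {V : Type} [Finite V] {G : SimpleGraph V}
    (A B : GeometricRealization G) : A.toClass ≤ B.toClass ↔ A.Precedes B := Iff.rfl

/-- The edge `e_i = {i, i + 1}` of the cycle on the vertices `1, …, n`; vertex labels are read
modulo `n`, so that vertex `n` is `0 : Fin n` and `e_n = {n, 1}`. -/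
def cycleEdge (n : ℕ) [NeZero n] (i : ℕ) : Sym2 (Fin n) :=
  s(Fin.ofNat n i, Fin.ofNat n (i + 1))

/-- The set of edge pairs `{e_i × e_j | (i, j) ∈ l}` of the cycle on `n` vertices. -/
def edgePairs (n : ℕ) [NeZero n] (l : List (ℕ × ℕ)) : Set (Sym2 (Sym2 (Fin n))) :=
  {c | ∃ p ∈ l, c = s(cycleEdge n p.1, cycleEdge n p.2)}

/-- The class `X` of realizations of the cycle `C_n` contains a realization whose set of crossings
is exactly `{e_i × e_j | (i, j) ∈ l}`. -/
def HasCrossings {n : ℕ} [NeZero n] (X : GeometricPoset (SimpleGraph.cycleGraph n))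
    (l : List (ℕ × ℕ)) : Prop :=
  ∃ A : GeometricRealization (SimpleGraph.cycleGraph n),
    A.toClass = X ∧ A.crossings = edgePairs n l

/-- The crossing sets of the two realizations of `C_4`. -/
def crossings₄ : Fin 2 → List (ℕ × ℕ) :=
  ![[], [(1, 3)]]

/-- The crossing sets of the five realizations of `C_5`. -/
def crossings₅ : Fin 5 → List (ℕ × ℕ) :=
  ![[],
    [(1, 3)],
    [(1, 3), (1, 4)],
    [(1, 3), (1, 4), (2, 4)],
    [(1, 3), (1, 4), (2, 4), (2, 5), (3, 5)]]

/-- Names of the twenty-six classes of realizations of `C_6`; `r_k_j` is the `j`-th class with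
`k` crossings. -/
inductive Label₆ : Type
  | r_0_1
  | r_1_1 | r_1_2
  | r_2_1 | r_2_2 | r_2_3
  | r_3_1 | r_3_2 | r_3_3 | r_3_4 | r_3_5 | r_3_6 | r_3_7 | r_3_8
  | r_4_1 | r_4_2 | r_4_3 | r_4_4 | r_4_5
  | r_5_1 | r_5_2 | r_5_3 | r_5_4
  | r_6_1 | r_6_2
  | r_7_1
  deriving DecidableEq

/-- The crossing sets of the twenty-six realizations of `C_6`. -/
def crossings₆ : Label₆ → List (ℕ × ℕ)
  | .r_0_1 => []
  | .r_1_1 => [(1, 3)]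
  | .r_1_2 => [(1, 4)]
  | .r_2_1 => [(1, 3), (1, 4)]
  | .r_2_2 => [(1, 3), (1, 5)]
  | .r_2_3 => [(1, 3), (4, 6)]
  | .r_3_1 => [(1, 3), (1, 4), (1, 5)]
  | .r_3_2 => [(1, 3), (1, 4), (2, 4)]
  | .r_3_3 => [(1, 3), (1, 4), (2, 5)]
  | .r_3_4 => [(1, 3), (1, 4), (3, 5)]
  | .r_3_5 => [(1, 3), (1, 4), (3, 6)]
  | .r_3_6 => [(1, 3), (1, 4), (4, 6)]
  | .r_3_7 => [(1, 3), (1, 5), (3, 5)]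
  | .r_3_8 => [(1, 4), (2, 5), (3, 6)]
  | .r_4_1 => [(1, 3), (1, 4), (1, 5), (2, 4)]
  | .r_4_2 => [(1, 3), (1, 4), (1, 5), (2, 5)]
  | .r_4_3 => [(1, 3), (1, 4), (1, 5), (3, 5)]
  | .r_4_4 => [(1, 3), (1, 4), (2, 5), (3, 5)]
  | .r_4_5 => [(1, 3), (1, 4), (3, 6), (4, 6)]
  | .r_5_1 => [(1, 3), (1, 4), (1, 5), (2, 4), (2, 5)]
  | .r_5_2 => [(1, 3), (1, 4), (2, 4), (2, 5), (3, 5)]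
  | .r_5_3 => [(1, 3), (1, 4), (2, 4), (2, 5), (3, 6)]
  | .r_5_4 => [(1, 3), (1, 4), (2, 5), (3, 6), (4, 6)]
  | .r_6_1 => [(1, 3), (1, 4), (1, 5), (2, 4), (2, 5), (3, 5)]
  | .r_6_2 => [(1, 3), (1, 4), (1, 5), (2, 4), (2, 5), (3, 6)]
  | .r_7_1 => [(1, 3), (1, 4), (1, 5), (2, 4), (2, 5), (3, 6), (4, 6)]

/-- The Hasse diagram of the poset of `C_6`: the elements that cover a given one. -/
def upperCovers₆ : Label₆ → List Label₆
  | .r_0_1 => [.r_1_1, .r_1_2]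
  | .r_1_1 => [.r_2_1, .r_2_2, .r_2_3]
  | .r_1_2 => [.r_2_1, .r_3_8]
  | .r_2_1 => [.r_3_1, .r_3_2, .r_3_3, .r_3_4, .r_3_5, .r_3_6]
  | .r_2_2 => [.r_3_1, .r_3_4, .r_3_7]
  | .r_2_3 => [.r_3_6]
  | .r_3_1 => [.r_4_1, .r_4_2, .r_4_3]
  | .r_3_2 => [.r_4_1, .r_5_2, .r_5_3]
  | .r_3_3 => [.r_4_2, .r_4_4, .r_5_3, .r_5_4]
  | .r_3_4 => [.r_4_2, .r_4_3, .r_4_4]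
  | .r_3_5 => [.r_4_2, .r_4_5, .r_5_2, .r_5_3]
  | .r_3_6 => [.r_4_1, .r_4_5]
  | .r_3_7 => [.r_4_3]
  | .r_3_8 => [.r_5_3, .r_5_4]
  | .r_4_1 => [.r_5_1]
  | .r_4_2 => [.r_5_1]
  | .r_4_3 => [.r_6_1]
  | .r_4_4 => [.r_5_2, .r_6_2]
  | .r_4_5 => [.r_5_1, .r_5_4]
  | .r_5_1 => [.r_6_1, .r_6_2]
  | .r_5_2 => [.r_6_1]
  | .r_5_3 => [.r_6_2]
  | .r_5_4 => [.r_6_2]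
  | .r_6_1 => []
  | .r_6_2 => [.r_7_1]
  | .r_7_1 => []

/-! The proof reduces the geometry to two finite computations. For points in general position, two
segments without a common endpoint cross exactly when the ends of each lie on opposite sides of the
line through the other. So the crossings of a drawing depend only on the signs of the oriented areas
of triples of vertices (`openSegment_inter_nonempty_iff`). An injective adjacency-preserving
self-map of a cycle is a rotation or a reflection (`exists_dihedralVertex_eq`). Hence `A ⪯ B` means
that some dihedral symmetry carries the crossing pairs of edges of `A` into those of `B`
(`GeometricRealization.precedes_iff`), and for listed crossing sets this is the decidable relation
`Embeds`. By `exists_equiv_geometricPoset`, the poset is then known once the listed sets are shown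
to be realizable, exhaustive up to symmetry, and pairwise inequivalent.

Realizability: explicit drawings with small integer coordinates, where all conditions are decidable;
for this reason `orient` and `ccw` are defined over any suitable ring. Exhaustiveness: the signs of
the triples obey the affine relation between four points and the three-term Grassmann–Plücker
relations between five. A search over all sign patterns allowed by these necessary conditions finds
no crossing set outside the lists. It does not matter whether every such pattern comes from points,
since only the resulting crossing sets are used and each listed one is drawn. Order: comparability
of the listed sets is decided over all symmetries, and the Hasse diagram is read off from it. -/

/-! ### Crossing of segments in terms of orientations -/

/-- Twice the signed area of the triangle `p q r`. -/
def orient {R : Type*} [CommRing R] (p q r : R × R) : R :=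
  (q.1 - p.1) * (r.2 - p.2) - (q.2 - p.2) * (r.1 - p.1)

theorem collinear_iff_orient_eq_zero (p q r : ℝ × ℝ) :
    Collinear ℝ ({p, q, r} : Set (ℝ × ℝ)) ↔ orient p q r = 0 := by
  rw [collinear_iff_of_mem (p₀ := p) (by simp)]
  constructor
  · rintro ⟨v, h⟩
    obtain ⟨s, hs⟩ := h q (by simp)
    obtain ⟨t, ht⟩ := h r (by simp)
    subst hs ht
    simp only [orient, vadd_eq_add, Prod.fst_add, Prod.snd_add, Prod.smul_fst, Prod.smul_snd,
      smul_eq_mul]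
    ring
  · intro h
    simp only [orient] at h
    by_cases hq : q = p
    · refine ⟨r - p, ?_⟩
      rintro x (rfl | rfl | rfl)
      · exact ⟨0, by simp⟩
      · exact ⟨0, by simp [hq]⟩
      · exact ⟨1, by simp⟩
    · refine ⟨q - p, ?_⟩
      rintro x (rfl | rfl | rfl)
      · exact ⟨0, by simp⟩
      · exact ⟨1, by simp⟩
      · by_cases h1 : q.1 - p.1 = 0
        · have h2 : q.2 - p.2 ≠ 0 := fun h2 =>
            hq (Prod.ext (sub_eq_zero.1 h1) (sub_eq_zero.1 h2))
          refine ⟨(x.2 - p.2) / (q.2 - p.2), Prod.ext ?_ ?_⟩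
          · simp only [vadd_eq_add, Prod.fst_add, Prod.smul_fst, smul_eq_mul, Prod.fst_sub]
            have : x.1 - p.1 = 0 := by
              rw [h1] at h
              simpa [h2] using h
            rw [h1]; linarith
          · simp only [vadd_eq_add, Prod.snd_add, Prod.smul_snd, smul_eq_mul, Prod.snd_sub]
            field_simp; ring
        · refine ⟨(x.1 - p.1) / (q.1 - p.1), Prod.ext ?_ ?_⟩
          · simp only [vadd_eq_add, Prod.fst_add, Prod.smul_fst, smul_eq_mul, Prod.fst_sub]
            field_simp; ring
          · simp only [vadd_eq_add, Prod.snd_add, Prod.smul_snd, smul_eq_mul, Prod.snd_sub]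
            field_simp; linarith

theorem mem_openSegment_prod {p q x : ℝ × ℝ} (h : x ∈ openSegment ℝ p q) :
    ∃ t : ℝ, 0 < t ∧ t < 1 ∧ x.1 = (1 - t) * p.1 + t * q.1 ∧ x.2 = (1 - t) * p.2 + t * q.2 := by
  obtain ⟨s, t, hs, ht, hst, rfl⟩ := h
  obtain rfl : s = 1 - t := by linarith
  exact ⟨t, ht, by linarith, by simp, by simp⟩

theorem orient_of_mem_openSegment {p q x : ℝ × ℝ} (h : x ∈ openSegment ℝ p q) :
    orient p q x = 0 := by
  obtain ⟨t, -, -, h1, h2⟩ := mem_openSegment_prod h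
  simp only [orient, h1, h2]; ring

/-- The line through `p` and `q` separates the endpoints of a segment that it meets. -/
theorem orient_pos_ne_of_openSegment_inter {p q r s : ℝ × ℝ}
    (h : (openSegment ℝ p q ∩ openSegment ℝ r s).Nonempty)
    (hr : orient p q r ≠ 0) (hs : orient p q s ≠ 0) :
    decide (0 < orient p q r) ≠ decide (0 < orient p q s) := by
  obtain ⟨x, hx, hy⟩ := h
  have h0 := orient_of_mem_openSegment hx
  obtain ⟨t, ht0, ht1, h1, h2⟩ := mem_openSegment_prod hy
  have key : (1 - t) * orient p q r + t * orient p q s = 0 := by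
    rw [← h0]; simp only [orient, h1, h2]; ring
  have ht1' : 0 < 1 - t := by linarith
  intro hd
  rcases hr.lt_or_gt with hr' | hr' <;> rcases hs.lt_or_gt with hs' | hs'
  · nlinarith [mul_pos_of_neg_of_neg (neg_neg_of_pos ht1') hr', mul_neg_of_pos_of_neg ht0 hs']
  · simp [hs'] at hd; linarith
  · simp [hr'] at hd; linarith
  · nlinarith [mul_pos ht1' hr', mul_pos ht0 hs']

theorem openSegment_inter_of_orient {p q r s : ℝ × ℝ}
    (h₁ : decide (0 < orient p q r) ≠ decide (0 < orient p q s))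
    (h₂ : decide (0 < orient r s p) ≠ decide (0 < orient r s q))
    (hr : orient p q r ≠ 0) (hs : orient p q s ≠ 0)
    (hp : orient r s p ≠ 0) (hq : orient r s q ≠ 0) :
    (openSegment ℝ p q ∩ openSegment ℝ r s).Nonempty := by
  -- An affine function with values `a` and `b` of opposite signs at the ends of a segment vanishes
  -- at the parameter `a / (a - b)`, which lies strictly between 0 and 1.
  have ratio : ∀ a b : ℝ, a ≠ 0 → b ≠ 0 → decide (0 < a) ≠ decide (0 < b) →
      a - b ≠ 0 ∧ 0 < a / (a - b) ∧ a / (a - b) < 1 := by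
    intro a b ha hb hab
    rcases ha.lt_or_gt with ha' | ha' <;> rcases hb.lt_or_gt with hb' | hb'
    · simp [ha'.not_gt, hb'.not_gt] at hab
    · have : a - b < 0 := by linarith
      exact ⟨this.ne, div_pos_of_neg_of_neg ha' this, (div_lt_one_of_neg this).2 (by linarith)⟩
    · have : 0 < a - b := by linarith
      exact ⟨this.ne', div_pos ha' this, (div_lt_one this).2 (by linarith)⟩
    · simp [ha', hb'] at hab
  obtain ⟨d1, s0, s1⟩ := ratio _ _ hr hs h₁
  obtain ⟨d2, t0, t1⟩ := ratio _ _ hp hq h₂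
  -- Up to sign, both denominators are the cross product of the direction vectors of the two
  -- segments, so one nonzero quantity serves for both parameters.
  have hd : orient r s p - orient r s q = -(orient p q r - orient p q s) := by
    simp only [orient]; ring
  rw [hd] at t0 t1
  refine ⟨(1 - orient r s p / -(orient p q r - orient p q s)) • p +
    (orient r s p / -(orient p q r - orient p q s)) • q,
    ⟨_, _, by linarith, t0, by ring, rfl⟩, ⟨1 - orient p q r / (orient p q r - orient p q s),
    orient p q r / (orient p q r - orient p q s), by linarith, s0, by ring, ?_⟩⟩
  generalize hD : orient p q r - orient p q s = D at *
  ext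
  · simp only [Prod.fst_add, Prod.smul_fst, smul_eq_mul]
    field_simp
    rw [← hD]; simp only [orient]; ring
  · simp only [Prod.snd_add, Prod.smul_snd, smul_eq_mul]
    field_simp
    rw [← hD]; simp only [orient]; ring

theorem openSegment_inter_common_endpoint {p q r : ℝ × ℝ} (h : orient p q r ≠ 0) :
    openSegment ℝ p q ∩ openSegment ℝ p r = ∅ := by
  rw [Set.eq_empty_iff_forall_notMem]
  rintro x ⟨hx, hy⟩
  have h0 := orient_of_mem_openSegment hx
  obtain ⟨t, ht, -, h1, h2⟩ := mem_openSegment_prod hy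
  have : t * orient p q r = 0 := by
    rw [← h0]; simp only [orient, h1, h2]; ring
  rcases mul_eq_zero.1 this with h' | h'
  · exact ht.ne' h'
  · exact h h'

/-- No three of the points are collinear. -/
def GeneralPosition {V : Type} (p : V → ℝ × ℝ) : Prop :=
  ∀ u v w : V, u ≠ v → u ≠ w → v ≠ w → orient (p u) (p v) (p w) ≠ 0

/-- Whether the triple `u v w` of points is counterclockwise. -/
def ccw {V R : Type} [CommRing R] [LinearOrder R] (p : V → R × R) (u v w : V) : Bool :=
  decide (0 < orient (p u) (p v) (p w))

/-- Whether the segments `u v` and `x y` cross, in terms of the orientations of triples. -/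
def crossTest {V : Type} [DecidableEq V] (χ : V → V → V → Bool) (u v x y : V) : Bool :=
  (u != x) && (u != y) && (v != x) && (v != y) &&
    (χ u v x != χ u v y) && (χ x y u != χ x y v)

theorem crossTest_eq_true {V : Type} [DecidableEq V] (χ : V → V → V → Bool) (u v x y : V) :
    crossTest χ u v x y = true ↔ u ≠ x ∧ u ≠ y ∧ v ≠ x ∧ v ≠ y ∧
      χ u v x ≠ χ u v y ∧ χ x y u ≠ χ x y v := by
  simp [crossTest, and_assoc]

/-- Two distinct segments with a common endpoint lie on different lines by general position, so
their open segments are disjoint; this matches the four inequalities in `crossTest`. With four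
distinct endpoints, crossing is mutual separation. -/
theorem openSegment_inter_nonempty_iff {V : Type} [DecidableEq V] {p : V → ℝ × ℝ}
    (hp : GeneralPosition p) {u v x y : V} (huv : u ≠ v) (hxy : x ≠ y) (hne : s(u, v) ≠ s(x, y)) :
    (openSegment ℝ (p u) (p v) ∩ openSegment ℝ (p x) (p y)).Nonempty ↔
      crossTest (ccw p) u v x y = true := by
  rw [crossTest_eq_true]
  have hne' : ¬ (u = x ∧ v = y) ∧ ¬ (u = y ∧ v = x) := by
    rw [Ne, Sym2.eq_iff] at hne; tauto
  constructor
  · intro h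
    have h1 : u ≠ x := by
      rintro rfl
      rw [openSegment_inter_common_endpoint (hp _ _ _ huv hxy (by tauto))] at h
      simp at h
    have h2 : u ≠ y := by
      rintro rfl
      rw [openSegment_symm ℝ (p x),
        openSegment_inter_common_endpoint (hp _ _ _ huv hxy.symm (by tauto))] at h
      simp at h
    have h3 : v ≠ x := by
      rintro rfl
      rw [openSegment_symm ℝ (p u),
        openSegment_inter_common_endpoint (hp _ _ _ huv.symm hxy (by tauto))] at h
      simp at h
    have h4 : v ≠ y := by
      rintro rfl
      rw [openSegment_symm ℝ (p u), openSegment_symm ℝ (p x),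
        openSegment_inter_common_endpoint (hp _ _ _ huv.symm hxy.symm (by tauto))] at h
      simp at h
    refine ⟨h1, h2, h3, h4, ?_, ?_⟩
    · exact orient_pos_ne_of_openSegment_inter h (hp _ _ _ huv h1 h3) (hp _ _ _ huv h2 h4)
    · exact orient_pos_ne_of_openSegment_inter (by rwa [Set.inter_comm])
        (hp _ _ _ hxy h1.symm h2.symm) (hp _ _ _ hxy h3.symm h4.symm)
  · rintro ⟨h1, h2, h3, h4, h5, h6⟩
    exact openSegment_inter_of_orient h5 h6 (hp _ _ _ huv h1 h3) (hp _ _ _ huv h2 h4)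
      (hp _ _ _ hxy h1.symm h2.symm) (hp _ _ _ hxy h3.symm h4.symm)

namespace GeometricRealization

theorem generalPosition {V : Type} {G : SimpleGraph V} (A : GeometricRealization G) :
    GeneralPosition A.pos := fun u v w h1 h2 h3 h =>
  A.not_collinear u v w h1 h2 h3 ((collinear_iff_orient_eq_zero _ _ _).2 h)

theorem cross_iff_crossTest {V : Type} [DecidableEq V] {G : SimpleGraph V}
    (A : GeometricRealization G) {u v x y : V} (huv : G.Adj u v) (hxy : G.Adj x y)
    (hne : s(u, v) ≠ s(x, y)) : A.Cross u v x y ↔ crossTest (ccw A.pos) u v x y = true := by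
  rw [← openSegment_inter_nonempty_iff A.generalPosition huv.ne hxy.ne hne]
  simp [Cross, huv, hxy, hne]

end GeometricRealization

/-! ### Sign relations between triples of points -/

/-- Orientations of the triples of points in general position satisfy `χ (q, r, p) = χ (p, q, r)`. -/
theorem ccw_rotate {V R : Type} [CommRing R] [LinearOrder R] (p : V → R × R) (u v w : V) :
    ccw p v w u = ccw p u v w := by
  simp only [ccw]
  congr 2
  simp only [orient]; ring

/-- The swap negates the area. General position is essential: for a collinear triple both Booleans
would be false. -/
theorem GeneralPosition.ccw_swap {V : Type} {p : V → ℝ × ℝ} (hp : GeneralPosition p) {u v w : V}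
    (h1 : u ≠ v) (h2 : u ≠ w) (h3 : v ≠ w) : ccw p v u w = !ccw p u v w := by
  have h : orient (p v) (p u) (p w) = -orient (p u) (p v) (p w) := by simp only [orient]; ring
  simp only [ccw, h, ← decide_not]
  have := hp u v w h1 h2 h3
  rw [decide_eq_decide, not_lt, Left.neg_pos_iff]
  exact ⟨le_of_lt, fun h => lt_of_le_of_ne h this⟩

/-- The affine relation between four points excludes that the four terms have equal signs. -/
def affineOk (a b c d : Bool) : Bool := !((a ^^ b) && !(a ^^ c) && !(b ^^ d))

/-- The Grassmann–Plücker relation between five points excludes that the three terms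
have equal signs. -/
def pluckerOk (a b c d e f : Bool) : Bool :=
  !(((a ^^ b) ^^ (c ^^ d)) && !((a ^^ b) ^^ (e ^^ f)))

/-- The alternating sum of the areas of the four triangles spanned by four points is zero, so its
four signed terms cannot all have the same sign. -/
theorem GeneralPosition.affineOk {V : Type} {p : V → ℝ × ℝ} (hp : GeneralPosition p) {a b c d : V}
    (hab : a ≠ b) (hac : a ≠ c) (had : a ≠ d) (hbc : b ≠ c) (hbd : b ≠ d) (hcd : c ≠ d) :
    affineOk (ccw p b c d) (ccw p a c d) (ccw p a b d) (ccw p a b c) = true := by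
  have key : orient (p b) (p c) (p d) - orient (p a) (p c) (p d) + orient (p a) (p b) (p d)
      - orient (p a) (p b) (p c) = 0 := by simp only [orient]; ring
  have h1 := hp b c d hbc hbd hcd
  have h2 := hp a c d hac had hcd
  have h3 := hp a b d hab had hbd
  have h4 := hp a b c hab hac hbc
  simp only [_root_.affineOk, ccw]
  generalize orient (p b) (p c) (p d) = x at *
  generalize orient (p a) (p c) (p d) = y at *
  generalize orient (p a) (p b) (p d) = z at *
  generalize orient (p a) (p b) (p c) = w at *
  rcases h1.lt_or_gt with h1 | h1 <;> rcases h2.lt_or_gt with h2 | h2 <;>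
  rcases h3.lt_or_gt with h3 | h3 <;> rcases h4.lt_or_gt with h4 | h4 <;>
  simp only [h1, h2, h3, h4, h1.not_gt, h2.not_gt, h3.not_gt, h4.not_gt, decide_true, decide_false]
    <;> first | rfl | (exfalso; linarith)

/-- The exclusive or of two sign bits records a negative product. Thus `pluckerOk` compares the
signs of three products using the bits of their factors alone. -/
theorem xor_decide_pos {x y : ℝ} (hx : x ≠ 0) (hy : y ≠ 0) :
    (decide (0 < x) ^^ decide (0 < y)) = !decide (0 < x * y) := by
  rcases hx.lt_or_gt with hx | hx <;> rcases hy.lt_or_gt with hy | hy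
  · simp [hx.not_gt, hy.not_gt, mul_pos_of_neg_of_neg hx hy]
  · simp [hx.not_gt, hy]
  · simp [hx, hy.not_gt]
  · simp [hx, hy]

theorem GeneralPosition.pluckerOk {V : Type} {p : V → ℝ × ℝ} (hp : GeneralPosition p)
    {a b c d e : V} (hab : a ≠ b) (hac : a ≠ c) (had : a ≠ d) (hae : a ≠ e) (hbc : b ≠ c)
    (hbd : b ≠ d) (hbe : b ≠ e) (hcd : c ≠ d) (hce : c ≠ e) (hde : d ≠ e) :
    pluckerOk (ccw p a b c) (ccw p a d e) (ccw p a b d) (ccw p a c e) (ccw p a b e)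
      (ccw p a c d) = true := by
  have key : orient (p a) (p b) (p c) * orient (p a) (p d) (p e)
      - orient (p a) (p b) (p d) * orient (p a) (p c) (p e)
      + orient (p a) (p b) (p e) * orient (p a) (p c) (p d) = 0 := by simp only [orient]; ring
  have a1 := hp a b c hab hac hbc
  have a2 := hp a d e had hae hde
  have a3 := hp a b d hab had hbd
  have a4 := hp a c e hac hae hce
  have a5 := hp a b e hab hae hbe
  have a6 := hp a c d hac had hcd
  simp only [_root_.pluckerOk, ccw]
  rw [xor_decide_pos a1 a2, xor_decide_pos a3 a4, xor_decide_pos a5 a6]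
  have h1 := mul_ne_zero a1 a2
  have h2 := mul_ne_zero a3 a4
  have h3 := mul_ne_zero a5 a6
  generalize orient (p a) (p b) (p c) * orient (p a) (p d) (p e) = x at *
  generalize orient (p a) (p b) (p d) * orient (p a) (p c) (p e) = y at *
  generalize orient (p a) (p b) (p e) * orient (p a) (p c) (p d) = z at *
  rcases h1.lt_or_gt with h1 | h1 <;> rcases h2.lt_or_gt with h2 | h2 <;>
  rcases h3.lt_or_gt with h3 | h3 <;>
  simp only [h1, h2, h3, h1.not_gt, h2.not_gt, h3.not_gt, decide_true, decide_false]
    <;> first | rfl | (exfalso; linarith)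

/-! ### Symmetries of the cycle -/

/-- The symmetry `i ↦ a + i` or `i ↦ a - i` of the cycle, on vertices. -/
def dihedralVertex {n : ℕ} [NeZero n] (a : Fin n) (b : Bool) (i : Fin n) : Fin n :=
  if b then a - i else a + i

/-- The symmetry `i ↦ a + i` or `i ↦ a - i` of the cycle, on the indices of the edges
`{i, i + 1}`. -/
def dihedralEdge {n : ℕ} [NeZero n] (a : Fin n) (b : Bool) (i : Fin n) : Fin n :=
  if b then a - i - 1 else a + i

theorem Fin.one_ne_zero_of_three_le {n : ℕ} [NeZero n] (hn : 3 ≤ n) : (1 : Fin n) ≠ 0 := by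
  obtain ⟨m, rfl⟩ := Nat.exists_eq_add_of_le' hn
  simp

theorem Fin.one_add_one_ne_zero_of_three_le {n : ℕ} [NeZero n] (hn : 3 ≤ n) :
    (1 + 1 : Fin n) ≠ 0 := by
  obtain ⟨m, rfl⟩ := Nat.exists_eq_add_of_le' hn
  intro h
  have := congrArg Fin.val h
  rw [Fin.val_add] at this
  simp [Nat.mod_eq_of_lt (by lia : 2 < m + 3)] at this

theorem Fin.ofNat_succ_eq {n : ℕ} [NeZero n] (k : ℕ) :
    Fin.ofNat n (k + 1) = Fin.ofNat n k + 1 := by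
  ext; simp [Fin.val_add]

/-- Induction around the cycle: every element is a multiple of 1. -/
theorem Fin.induction_add_one {n : ℕ} [NeZero n] {P : Fin n → Prop} (h0 : P 0)
    (h : ∀ i, P i → P (i + 1)) (i : Fin n) : P i := by
  have key : ∀ k : ℕ, P (Fin.ofNat n k) := by
    intro k
    induction k with
    | zero => simpa using h0
    | succ k ih => rw [Fin.ofNat_succ_eq]; exact h _ ih
  have := key i
  simpa using this

theorem cycleGraph_adj_iff {n : ℕ} [NeZero n] (hn : 3 ≤ n) (u v : Fin n) :
    (SimpleGraph.cycleGraph n).Adj u v ↔ v = u + 1 ∨ u = v + 1 := by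
  obtain ⟨m, rfl⟩ := Nat.exists_eq_add_of_le' hn
  rw [SimpleGraph.cycleGraph_adj, sub_eq_iff_eq_add, sub_eq_iff_eq_add, add_comm 1 v,
    add_comm 1 u, or_comm]

theorem cycleGraph_adj_succ {n : ℕ} [NeZero n] (hn : 3 ≤ n) (i : Fin n) :
    (SimpleGraph.cycleGraph n).Adj i (i + 1) :=
  (cycleGraph_adj_iff hn _ _).2 (Or.inl rfl)

theorem succ_edge_injective {n : ℕ} [NeZero n] (hn : 3 ≤ n) {i j : Fin n}
    (h : s(i, i + 1) = s(j, j + 1)) : i = j := by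
  rcases Sym2.eq_iff.1 h with h | ⟨h1, h2⟩
  · exact h.1
  · rw [h1, add_assoc, add_eq_left] at h2
    exact absurd h2 (Fin.one_add_one_ne_zero_of_three_le hn)

/-- Each step along the cycle is mapped to a step forwards or backwards. Turning around would send
`i` and `i + 2` to the same vertex, which injectivity forbids because `2 ≠ 0` when `n ≥ 3`. So the
direction of the first step persists, and it and `f 0` determine the map. -/
theorem exists_dihedralVertex_eq {n : ℕ} [NeZero n] (hn : 3 ≤ n) {f : Fin n → Fin n}
    (hf : Function.Injective f) (hadj : ∀ u v, (SimpleGraph.cycleGraph n).Adj u v →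
      (SimpleGraph.cycleGraph n).Adj (f u) (f v)) :
    ∃ a b, f = dihedralVertex a b := by
  have step : ∀ i, f (i + 1) = f i + 1 ∨ f i = f (i + 1) + 1 := fun i =>
    (cycleGraph_adj_iff hn _ _).1 (hadj _ _ (cycleGraph_adj_succ hn i))
  have ne : ∀ i, f (i + 1 + 1) ≠ f i := by
    intro i h
    have := hf h
    rw [add_assoc, add_eq_left] at this
    exact Fin.one_add_one_ne_zero_of_three_le hn this
  rcases step 0 with h0 | h0
  · have h : ∀ i, f (i + 1) = f i + 1 := by
      refine Fin.induction_add_one h0 fun i hi => ?_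
      refine (step (i + 1)).resolve_right fun h => ne i ?_
      rw [hi] at h
      exact (add_right_cancel h).symm
    refine ⟨f 0, false, funext fun i => ?_⟩
    refine Fin.induction_add_one (P := fun i => f i = dihedralVertex (f 0) false i)
      (by simp [dihedralVertex]) (fun i hi => ?_) i
    rw [h, hi]
    simp [dihedralVertex, add_assoc]
  · have h : ∀ i, f i = f (i + 1) + 1 := by
      refine Fin.induction_add_one h0 fun i hi => ?_
      refine (step (i + 1)).resolve_left fun h => ne i ?_
      rw [h, hi]
    refine ⟨f 0, true, funext fun i => ?_⟩
    refine Fin.induction_add_one (P := fun i => f i = dihedralVertex (f 0) true i)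
      (by simp [dihedralVertex]) (fun i hi => ?_) i
    rw [eq_comm, ← sub_eq_iff_eq_add.2 (h i), hi]
    simp only [dihedralVertex, if_true]
    abel

theorem dihedralVertex_injective {n : ℕ} [NeZero n] (a : Fin n) (b : Bool) :
    Function.Injective (dihedralVertex a b) := by
  intro i j h
  cases b <;> simpa [dihedralVertex] using h

/-- A reflection sends `{i, i + 1}` to `{a - i, a - i - 1}`, the edge with index `a - i - 1`; hence
the shift by one in `dihedralEdge`. -/
theorem dihedralVertex_edge {n : ℕ} [NeZero n] (a : Fin n) (b : Bool) (i : Fin n) :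
    s(dihedralVertex a b i, dihedralVertex a b (i + 1)) =
      s(dihedralEdge a b i, dihedralEdge a b i + 1) := by
  cases b
  · simp [dihedralVertex, dihedralEdge, add_assoc]
  · rw [Sym2.eq_swap]
    simp [dihedralVertex, dihedralEdge, ← sub_sub]

/-- A reflection of the edges is an involution, while the rotation by `a` is undone by the rotation
by `-a`. -/
theorem dihedralEdge_dihedralEdge {n : ℕ} [NeZero n] (a : Fin n) (b : Bool) (i : Fin n) :
    dihedralEdge a b (dihedralEdge (if b then a else -a) b i) = i := by
  cases b
  · simp [dihedralEdge]
  · simp only [dihedralEdge, if_true]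
    abel

/-! ### Crossing pairs of edges and the order -/

namespace GeometricRealization

theorem Cross.symm {V : Type} {G : SimpleGraph V} {A : GeometricRealization G} {u v x y : V}
    (h : A.Cross u v x y) : A.Cross x y u v :=
  ⟨h.2.1, h.1, h.2.2.1.symm, by rw [Set.inter_comm]; exact h.2.2.2⟩

theorem cross_congr {V : Type} {G : SimpleGraph V} (A : GeometricRealization G)
    {u v x y u' v' x' y' : V} (h₁ : s(u, v) = s(u', v')) (h₂ : s(x, y) = s(x', y')) :
    A.Cross u v x y ↔ A.Cross u' v' x' y' := by
  have swap : ∀ {u v x y : V}, A.Cross u v x y → A.Cross v u x y := by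
    rintro u v x y ⟨h1, h2, h3, h4⟩
    exact ⟨h1.symm, h2, by rwa [Sym2.eq_swap], by rwa [openSegment_symm]⟩
  have swap' : ∀ {u v x y : V}, A.Cross u v x y → A.Cross u v y x := fun h => (swap h.symm).symm
  rcases Sym2.eq_iff.1 h₁ with ⟨rfl, rfl⟩ | ⟨rfl, rfl⟩ <;>
  rcases Sym2.eq_iff.1 h₂ with ⟨rfl, rfl⟩ | ⟨rfl, rfl⟩
  · rfl
  · exact ⟨swap', swap'⟩
  · exact ⟨swap, swap⟩
  · exact ⟨fun h => swap (swap' h), fun h => swap (swap' h)⟩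

/-- The edges `{i, i + 1}` and `{j, j + 1}` of a realization of the cycle cross. -/
def EdgeCross {n : ℕ} [NeZero n] (A : GeometricRealization (SimpleGraph.cycleGraph n))
    (i j : Fin n) : Prop :=
  A.Cross i (i + 1) j (j + 1)

section Cycle

variable {n : ℕ} [NeZero n]

theorem edgeCross_iff_crossTest (hn : 3 ≤ n)
    (A : GeometricRealization (SimpleGraph.cycleGraph n)) (i j : Fin n) :
    A.EdgeCross i j ↔ crossTest (ccw A.pos) i (i + 1) j (j + 1) = true := by
  by_cases hij : i = j
  · subst hij
    simp [EdgeCross, Cross, crossTest]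
  · exact A.cross_iff_crossTest (cycleGraph_adj_succ hn i) (cycleGraph_adj_succ hn j)
      fun h => hij (succ_edge_injective hn h)

theorem Cross.exists_edgeCross (hn : 3 ≤ n) {A : GeometricRealization (SimpleGraph.cycleGraph n)}
    {u v x y : Fin n} (h : A.Cross u v x y) :
    ∃ i j, s(u, v) = s(i, i + 1) ∧ s(x, y) = s(j, j + 1) ∧ A.EdgeCross i j := by
  have key : ∀ {u v : Fin n}, (SimpleGraph.cycleGraph n).Adj u v → ∃ i, s(u, v) = s(i, i + 1) := by
    intro u v huv
    rcases (cycleGraph_adj_iff hn u v).1 huv with rfl | rfl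
    · exact ⟨u, rfl⟩
    · exact ⟨v, Sym2.eq_swap⟩
  obtain ⟨i, hi⟩ := key h.1
  obtain ⟨j, hj⟩ := key h.2.1
  exact ⟨i, j, hi, hj, (A.cross_congr hi hj).1 h⟩

/-- This replaces a quantifier over vertex maps by one over the `2n` choices of `a` and `b`, and
crossings of vertex pairs by crossings of edge indices. -/
theorem precedes_iff (hn : 3 ≤ n) (A B : GeometricRealization (SimpleGraph.cycleGraph n)) :
    A.Precedes B ↔ ∃ a b, ∀ i j, A.EdgeCross i j →
      B.EdgeCross (dihedralEdge a b i) (dihedralEdge a b j) := by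
  constructor
  · rintro ⟨f, hf, h⟩
    obtain ⟨a, b, rfl⟩ := exists_dihedralVertex_eq hn hf h.map_adj
    refine ⟨a, b, fun i j hij => ?_⟩
    exact (B.cross_congr (dihedralVertex_edge a b i) (dihedralVertex_edge a b j)).1
      (h.map_cross _ _ _ _ hij)
  · rintro ⟨a, b, h⟩
    refine ⟨dihedralVertex a b, dihedralVertex_injective a b, fun u v huv => ?_,
      fun u v x y hc => ?_⟩
    · rw [cycleGraph_adj_iff hn] at huv ⊢
      rcases huv with rfl | rfl <;> cases b <;> simp [dihedralVertex, add_assoc, ← sub_sub]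
    · obtain ⟨i, j, hi, hj, hij⟩ := hc.exists_edgeCross hn
      have e : ∀ {u v i : Fin n}, s(u, v) = s(i, i + 1) →
          s(dihedralVertex a b u, dihedralVertex a b v) =
            s(dihedralEdge a b i, dihedralEdge a b i + 1) := by
        intro u v i hi
        rw [← dihedralVertex_edge, ← Sym2.map_mk, ← Sym2.map_mk, hi]
      exact (B.cross_congr (e hi) (e hj)).2 (h i j hij)

end Cycle

end GeometricRealization

/-! ### The combinatorial model of the poset -/

/-- Whether the list contains the pair of the edges `{i, i + 1}` and `{j, j + 1}`, in either
order. -/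
def pairRel {n : ℕ} [NeZero n] (l : List (ℕ × ℕ)) (i j : Fin n) : Bool :=
  l.any fun p => (Fin.ofNat n p.1 == i && Fin.ofNat n p.2 == j) ||
    (Fin.ofNat n p.1 == j && Fin.ofNat n p.2 == i)

theorem pairRel_eq_true {n : ℕ} [NeZero n] (l : List (ℕ × ℕ)) (i j : Fin n) :
    pairRel l i j = true ↔ ∃ p ∈ l, (Fin.ofNat n p.1 = i ∧ Fin.ofNat n p.2 = j) ∨
      (Fin.ofNat n p.1 = j ∧ Fin.ofNat n p.2 = i) := by
  simp only [pairRel, List.any_eq_true, Bool.or_eq_true, Bool.and_eq_true, beq_iff_eq]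

theorem pairRel_symm {n : ℕ} [NeZero n] (l : List (ℕ × ℕ)) (i j : Fin n) :
    pairRel l i j = pairRel l j i := by
  simp only [pairRel, Bool.or_comm]

/-- Some symmetry of the cycle maps the first set of edge pairs into the second. -/
def Embeds (n : ℕ) [NeZero n] (l l' : List (ℕ × ℕ)) : Prop :=
  ∃ (a : Fin n) (b : Bool), ∀ p ∈ l, pairRel l' (dihedralEdge a b (Fin.ofNat n p.1))
    (dihedralEdge a b (Fin.ofNat n p.2)) = true

instance (n : ℕ) [NeZero n] (l l' : List (ℕ × ℕ)) : Decidable (Embeds n l l') :=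
  inferInstanceAs (Decidable (∃ (a : Fin n) (b : Bool), ∀ p ∈ l, pairRel l'
    (dihedralEdge a b (Fin.ofNat n p.1)) (dihedralEdge a b (Fin.ofNat n p.2)) = true))

namespace GeometricRealization

variable {n : ℕ} [NeZero n]

theorem crossings_eq_edgePairs (hn : 3 ≤ n)
    {A : GeometricRealization (SimpleGraph.cycleGraph n)} {l : List (ℕ × ℕ)}
    (h : ∀ i j, A.EdgeCross i j ↔ pairRel l i j = true) : A.crossings = edgePairs n l := by
  ext c
  constructor
  · rintro ⟨u, v, x, y, hc, rfl⟩
    obtain ⟨i, j, hi, hj, hij⟩ := hc.exists_edgeCross hn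
    obtain ⟨p, hp, ⟨rfl, rfl⟩ | ⟨rfl, rfl⟩⟩ := (pairRel_eq_true l i j).1 ((h i j).1 hij)
    · exact ⟨p, hp, by rw [hi, hj]; simp only [cycleEdge, Fin.ofNat_succ_eq]⟩
    · exact ⟨p, hp, by rw [hi, hj, Sym2.eq_swap]; simp only [cycleEdge, Fin.ofNat_succ_eq]⟩
  · rintro ⟨p, hp, rfl⟩
    refine ⟨_, _, _, _, (h (Fin.ofNat n p.1) (Fin.ofNat n p.2)).2
      ((pairRel_eq_true _ _ _).2 ⟨p, hp, Or.inl ⟨rfl, rfl⟩⟩), ?_⟩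
    simp only [cycleEdge, Fin.ofNat_succ_eq]

theorem precedes_iff_embeds (hn : 3 ≤ n)
    {A B : GeometricRealization (SimpleGraph.cycleGraph n)} {l l' : List (ℕ × ℕ)}
    (hA : ∀ i j, A.EdgeCross i j ↔ pairRel l i j = true)
    (hB : ∀ i j, B.EdgeCross i j ↔ pairRel l' i j = true) :
    A.Precedes B ↔ Embeds n l l' := by
  rw [precedes_iff hn]
  refine exists_congr fun a => exists_congr fun b => ?_
  simp only [hA, hB]
  constructor
  · exact fun h p hp => h _ _ ((pairRel_eq_true _ _ _).2 ⟨p, hp, Or.inl ⟨rfl, rfl⟩⟩)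
  · intro h i j hij
    obtain ⟨p, hp, ⟨rfl, rfl⟩ | ⟨rfl, rfl⟩⟩ := (pairRel_eq_true l i j).1 hij
    · exact h p hp
    · rw [pairRel_symm]; exact h p hp

/-- The symmetry gives `A ⪯ B` and its inverse gives `B ⪯ A`, so antisymmetry applies. -/
theorem isomorphic_of_edgeCross_iff (hn : 3 ≤ n)
    {A B : GeometricRealization (SimpleGraph.cycleGraph n)} {a : Fin n} {b : Bool}
    (h : ∀ i j, A.EdgeCross i j ↔ B.EdgeCross (dihedralEdge a b i) (dihedralEdge a b j)) :
    A.Isomorphic B := by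
  refine Precedes.antisymm ((precedes_iff hn A B).2 ⟨a, b, fun i j => (h i j).1⟩)
    ((precedes_iff hn B A).2 ⟨if b then a else -a, b, fun i j hij => (h _ _).2 ?_⟩)
  rwa [dihedralEdge_dihedralEdge, dihedralEdge_dihedralEdge]

end GeometricRealization

/-- A list of realizable sets of crossings, pairwise inequivalent under the symmetries of the cycle,
and exhaustive up to these symmetries, describes the poset of the cycle. -/
theorem exists_equiv_geometricPoset {n : ℕ} [NeZero n] (hn : 3 ≤ n) {ι : Type}
    (c : ι → List (ℕ × ℕ))
    (realizable : ∀ k, ∃ A : GeometricRealization (SimpleGraph.cycleGraph n),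
      ∀ i j, A.EdgeCross i j ↔ pairRel (c k) i j = true)
    (exhaustive : ∀ A : GeometricRealization (SimpleGraph.cycleGraph n), ∃ k a b,
      ∀ i j, A.EdgeCross i j ↔ pairRel (c k) (dihedralEdge a b i) (dihedralEdge a b j) = true)
    (inequivalent : ∀ k l, Embeds n (c k) (c l) → Embeds n (c l) (c k) → k = l) :
    ∃ r : ι ≃ GeometricPoset (SimpleGraph.cycleGraph n), (∀ k, HasCrossings (r k) (c k)) ∧
      ∀ k l, r k ≤ r l ↔ Embeds n (c k) (c l) := by
  choose A hA using realizable
  have hle : ∀ k l, (A k).toClass ≤ (A l).toClass ↔ Embeds n (c k) (c l) := fun k l =>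
    (GeometricRealization.toClass_le_toClass _ _).trans
      (GeometricRealization.precedes_iff_embeds hn (hA k) (hA l))
  have hbij : Function.Bijective fun k => (A k).toClass := by
    constructor
    · intro k l hkl
      exact inequivalent k l ((hle k l).1 hkl.le) ((hle l k).1 hkl.ge)
    · intro Y
      induction Y using Quotient.inductionOn with
      | h B =>
        obtain ⟨k, a, b, h⟩ := exhaustive B
        refine ⟨k, Quotient.sound (s := GeometricRealization.setoid _)
          (GeometricRealization.Isomorphic.symm ?_)⟩
        exact GeometricRealization.isomorphic_of_edgeCross_iff hn
          fun i j => (h i j).trans (hA k _ _).symm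
  exact ⟨Equiv.ofBijective _ hbij,
    fun k => ⟨A k, rfl, GeometricRealization.crossings_eq_edgePairs hn (hA k)⟩, hle⟩

/-! ### Realizations from integer drawings -/

/-- The integer analogue of an open-segment drawing of the cycle: no three points are collinear, and
no three pairwise crossing edges span concurrent lines. -/
def IsGridDrawing {n : ℕ} [NeZero n] (p : Fin n → ℤ × ℤ) : Prop :=
  (∀ u v w : Fin n, u ≠ v → u ≠ w → v ≠ w → orient (p u) (p v) (p w) ≠ 0) ∧
  ∀ i j k : Fin n, crossTest (ccw p) i (i + 1) j (j + 1) = true →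
    crossTest (ccw p) i (i + 1) k (k + 1) = true →
    crossTest (ccw p) j (j + 1) k (k + 1) = true →
    orient (p i) (p (i + 1)) (p j) * orient (p k) (p (k + 1)) (p (j + 1)) ≠
      orient (p i) (p (i + 1)) (p (j + 1)) * orient (p k) (p (k + 1)) (p j)

instance {n : ℕ} [NeZero n] (p : Fin n → ℤ × ℤ) : Decidable (IsGridDrawing p) :=
  inferInstanceAs (Decidable (_ ∧ _))

/-- Integer points as points of the plane. -/
def gridPoint {V : Type} (p : V → ℤ × ℤ) (i : V) : ℝ × ℝ := ((p i).1, (p i).2)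

theorem orient_gridPoint {V : Type} (p : V → ℤ × ℤ) (u v w : V) :
    orient (gridPoint p u) (gridPoint p v) (gridPoint p w) = (orient (p u) (p v) (p w) : ℤ) := by
  simp [orient, gridPoint]

theorem ccw_gridPoint {V : Type} (p : V → ℤ × ℤ) : ccw (gridPoint p) = ccw p := by
  funext u v w
  simp only [ccw, orient_gridPoint, Int.cast_pos]

/-- If a point of the line `r s` lies on the lines `p q` and `p' q'`, then these divide
`r s` in the same ratio. -/
theorem orient_mul_orient_eq {p q p' q' r s x : ℝ × ℝ} (h₁ : x ∈ openSegment ℝ p q)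
    (h₂ : x ∈ openSegment ℝ p' q') (h₃ : x ∈ openSegment ℝ r s) :
    orient p q r * orient p' q' s = orient p q s * orient p' q' r := by
  have e1 := orient_of_mem_openSegment h₁
  have e2 := orient_of_mem_openSegment h₂
  obtain ⟨t, ht, ht', hx, hy⟩ := mem_openSegment_prod h₃
  have k1 : (1 - t) * orient p q r + t * orient p q s = 0 := by
    rw [← e1]; simp only [orient, hx, hy]; ring
  have k2 : (1 - t) * orient p' q' r + t * orient p' q' s = 0 := by
    rw [← e2]; simp only [orient, hx, hy]; ring
  have : t * (orient p q r * orient p' q' s - orient p q s * orient p' q' r) = 0 := by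
    linear_combination orient p q r * k2 - orient p' q' r * k1
  exact sub_eq_zero.1 ((mul_eq_zero.1 this).resolve_left ht.ne')

theorem IsGridDrawing.exists_realization {n : ℕ} [NeZero n] (hn : 3 ≤ n) {p : Fin n → ℤ × ℤ}
    (hp : IsGridDrawing p) : ∃ A : GeometricRealization (SimpleGraph.cycleGraph n),
      ∀ i j, A.EdgeCross i j ↔ crossTest (ccw p) i (i + 1) j (j + 1) = true := by
  have hgen : GeneralPosition (gridPoint p) := by
    intro u v w h1 h2 h3
    rw [orient_gridPoint, Int.cast_ne_zero]
    exact hp.1 u v w h1 h2 h3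
  have edge : ∀ {u v : Fin n}, (SimpleGraph.cycleGraph n).Adj u v → ∃ i, s(u, v) = s(i, i + 1) ∧
      openSegment ℝ (gridPoint p u) (gridPoint p v) =
        openSegment ℝ (gridPoint p i) (gridPoint p (i + 1)) := by
    intro u v huv
    rcases (cycleGraph_adj_iff hn u v).1 huv with rfl | rfl
    · exact ⟨u, rfl, rfl⟩
    · exact ⟨v, Sym2.eq_swap, openSegment_symm _ _ _⟩
  have ne1 : ∀ i : Fin n, i ≠ i + 1 := fun i h =>
    Fin.one_ne_zero_of_three_le hn (left_eq_add.1 h)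
  refine ⟨⟨gridPoint p, ?_, ?_, ?_⟩, ?_⟩
  · intro u v huv
    by_contra hne
    -- Two coinciding points would be collinear with any third vertex, and one exists because `n ≥
    -- 3`.
    obtain ⟨w, hw⟩ : ∃ w, w ∉ ({u, v} : Finset (Fin n)) := by
      by_contra! hall
      have h1 := Finset.card_le_card (fun w _ => hall w : Finset.univ ⊆ ({u, v} : Finset (Fin n)))
      have h2 := Finset.card_le_two (a := u) (b := v)
      rw [Finset.card_univ, Fintype.card_fin] at h1
      omega
    simp only [Finset.mem_insert, Finset.mem_singleton, not_or] at hw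
    refine hgen u v w hne (Ne.symm hw.1) (Ne.symm hw.2) ?_
    rw [huv]; simp [orient]
  · intro u v w h1 h2 h3 h
    exact hgen u v w h1 h2 h3 ((collinear_iff_orient_eq_zero _ _ _).1 h)
  · intro u₁ v₁ u₂ v₂ u₃ v₃ h₁ h₂ h₃ h12 h13 h23
    obtain ⟨i, hi, ei⟩ := edge h₁
    obtain ⟨j, hj, ej⟩ := edge h₂
    obtain ⟨k, hk, ek⟩ := edge h₃
    rw [hi, hj] at h12
    rw [hi, hk] at h13
    rw [hj, hk] at h23
    rw [ei, ej, ek, Set.eq_empty_iff_forall_notMem]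
    rintro x ⟨⟨hxi, hxj⟩, hxk⟩
    -- A common interior point makes the three edges cross pairwise, so the concurrency condition of
    -- `IsGridDrawing` applies to them.
    have c12 := (openSegment_inter_nonempty_iff hgen (ne1 i) (ne1 j) h12).1 ⟨x, hxi, hxj⟩
    have c13 := (openSegment_inter_nonempty_iff hgen (ne1 i) (ne1 k) h13).1 ⟨x, hxi, hxk⟩
    have c23 := (openSegment_inter_nonempty_iff hgen (ne1 j) (ne1 k) h23).1 ⟨x, hxj, hxk⟩
    rw [ccw_gridPoint] at c12 c13 c23
    refine hp.2 i j k c12 c13 c23 ?_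
    have := orient_mul_orient_eq hxi hxk hxj
    simp only [orient_gridPoint] at this
    exact_mod_cast this
  · intro i j
    rw [GeometricRealization.edgeCross_iff_crossTest hn, ccw_gridPoint]

instance : Fintype Label₆ where
  elems := {.r_0_1, .r_1_1, .r_1_2, .r_2_1, .r_2_2, .r_2_3, .r_3_1, .r_3_2,
    .r_3_3, .r_3_4, .r_3_5, .r_3_6, .r_3_7, .r_3_8, .r_4_1, .r_4_2,
    .r_4_3, .r_4_4, .r_4_5, .r_5_1, .r_5_2, .r_5_3, .r_5_4, .r_6_1,
    .r_6_2, .r_7_1}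
  complete := by intro a; cases a <;> decide

/-- Drawings of the cycle `C_4` with the listed crossings. -/
def drawing₄ : Fin 2 → Fin 4 → ℤ × ℤ :=
  ![![(1, 1), (3, 2), (3, 3), (0, 1)],
    ![(1, 1), (3, 2), (0, 3), (3, 3)]]

/-- Drawings of the cycle `C_5` with the listed crossings. -/
def drawing₅ : Fin 5 → Fin 5 → ℤ × ℤ :=
  ![![(1, 0), (1, 1), (2, 1), (2, 2), (3, 0)],
    ![(1, 0), (3, 1), (0, 3), (2, 3), (1, 2)],
    ![(2, 3), (1, 3), (3, 0), (2, 2), (1, 1)],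
    ![(2, 0), (3, 3), (0, 1), (2, 2), (1, 3)],
    ![(1, 2), (0, 0), (3, 2), (0, 1), (3, 0)]]

/-- Drawings of the cycle `C_6` with the listed crossings. -/
def drawing₆ : Label₆ → Fin 6 → ℤ × ℤ
  | .r_0_1 => ![(1, 2), (3, 0), (3, 1), (1, 3), (0, 2), (0, 0)]
  | .r_1_1 => ![(1, 1), (0, 1), (3, 0), (2, 0), (3, 2), (2, 2)]
  | .r_1_2 => ![(3, 0), (3, 1), (0, 1), (0, 2), (2, 2), (1, 0)]
  | .r_2_1 => ![(1, 3), (3, 3), (2, 0), (0, 1), (3, 0), (2, 1)]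
  | .r_2_2 => ![(2, 0), (3, 1), (0, 2), (1, 0), (1, 3), (2, 3)]
  | .r_2_3 => ![(0, 3), (1, 1), (3, 2), (3, 0), (1, 3), (0, 2)]
  | .r_3_1 => ![(3, 1), (1, 0), (2, 3), (0, 2), (3, 3), (1, 1)]
  | .r_3_2 => ![(1, 0), (2, 1), (0, 3), (1, 1), (2, 3), (0, 0)]
  | .r_3_3 => ![(0, 3), (3, 1), (0, 0), (1, 2), (2, 0), (1, 1)]
  | .r_3_4 => ![(3, 0), (1, 0), (1, 3), (3, 2), (0, 1), (2, 2)]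
  | .r_3_5 => ![(3, 1), (1, 1), (4, 3), (4, 0), (0, 3), (3, 2)]
  | .r_3_6 => ![(1, 2), (1, 0), (3, 3), (2, 3), (2, 1), (0, 2)]
  | .r_3_7 => ![(0, 3), (3, 2), (1, 0), (0, 1), (3, 1), (2, 0)]
  | .r_3_8 => ![(5, 2), (1, 5), (5, 3), (6, 0), (4, 3), (6, 5)]
  | .r_4_1 => ![(0, 2), (1, 3), (2, 0), (2, 2), (1, 0), (3, 3)]
  | .r_4_2 => ![(0, 1), (3, 3), (1, 0), (2, 1), (2, 2), (3, 0)]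
  | .r_4_3 => ![(1, 3), (0, 1), (3, 3), (2, 2), (1, 2), (3, 0)]
  | .r_4_4 => ![(5, 3), (0, 5), (1, 0), (2, 4), (0, 3), (1, 4)]
  | .r_4_5 => ![(2, 2), (1, 4), (4, 0), (0, 1), (2, 4), (1, 1)]
  | .r_5_1 => ![(1, 0), (0, 2), (3, 0), (0, 3), (1, 1), (2, 3)]
  | .r_5_2 => ![(1, 3), (2, 2), (3, 0), (0, 1), (3, 2), (1, 0)]
  | .r_5_3 => ![(1, 1), (3, 2), (0, 1), (2, 0), (1, 3), (0, 0)]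
  | .r_5_4 => ![(1, 3), (4, 4), (0, 3), (2, 2), (2, 4), (3, 0)]
  | .r_6_1 => ![(1, 1), (2, 3), (1, 0), (3, 2), (0, 0), (3, 1)]
  | .r_6_2 => ![(1, 2), (0, 0), (2, 3), (2, 0), (0, 3), (3, 2)]
  | .r_7_1 => ![(1, 3), (1, 1), (3, 3), (2, 1), (0, 2), (3, 2)]

/-! ### Enumeration of sign patterns -/

/-- Universal quantification over a Boolean variable. -/
def forallBool (f : Bool → Bool) : Bool := f false && f true

/-- Boolean implication. -/
def impBool (a b : Bool) : Bool := !a || b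

theorem apply_of_forallBool {f : Bool → Bool} (h : forallBool f = true) (b : Bool) :
    f b = true := by
  rw [forallBool, Bool.and_eq_true] at h
  cases b
  · exact h.1
  · exact h.2

theorem of_impBool {a b : Bool} (h : impBool a b = true) (ha : a = true) : b = true := by
  simpa [impBool, ha] using h

/-- Whether two segments cross, given the orientations of the four triples of endpoints. -/
def separated (a b c d : Bool) : Bool := (a ^^ b) && (c ^^ d)

/-- The number with the given binary digits, the least significant first. -/
def bitMask (l : List Bool) : ℕ := l.foldr (fun b m => b.toNat + 2 * m) 0

/-- The set of all crossing sets of drawings of `C_6`, as a set of bit masks. -/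
def crossingMasks₆ : ℕ :=
  55033882729768522560247311227203295998094152277980649074270961386402289718582772110430969180227766013949510234066342318420390686758057110600375084899839

/-- The pairs of disjoint edges of `C_4`. -/
def disjointEdges₄ : List (Fin 4 × Fin 4) :=
  [(0, 2), (1, 3)]

/-- The pairs of disjoint edges of `C_5`. -/
def disjointEdges₅ : List (Fin 5 × Fin 5) :=
  [(0, 2), (0, 3), (1, 3), (1, 4), (2, 4)]

/-- The pairs of disjoint edges of `C_6`. -/
def disjointEdges₆ : List (Fin 6 × Fin 6) :=
  [(0, 2), (0, 3), (0, 4), (1, 3), (1, 4), (1, 5), (2, 4), (2, 5), (3, 5)]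

/-- A symmetric relation that never holds between equal or consecutive edges is determined by its
values on the disjoint pairs, so comparing finite lists of Booleans suffices. -/
theorem forall_edges_of_disjointEdges {n : ℕ} [NeZero n] {ps : List (Fin n × Fin n)}
    (hps : ∀ i j : Fin n, (i, j) ∈ ps ∨ (j, i) ∈ ps ∨ j = i ∨ j = i + 1 ∨ i = j + 1)
    {f g : Fin n → Fin n → Bool} (hf : ∀ i j, f i j = f j i) (hg : ∀ i j, g i j = g j i)
    (hf' : ∀ i, f i i = false ∧ f i (i + 1) = false)
    (hg' : ∀ i, g i i = false ∧ g i (i + 1) = false)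
    (h : ps.map (fun p => f p.1 p.2) = ps.map fun p => g p.1 p.2) (i j : Fin n) :
    f i j = g i j := by
  rw [List.map_inj_left] at h
  rcases hps i j with hij | hij | rfl | rfl | rfl
  · exact h _ hij
  · rw [hf, hg]; exact h _ hij
  · rw [(hf' _).1, (hg' _).1]
  · rw [(hf' _).2, (hg' _).2]
  · rw [hf, hg, (hf' _).2, (hg' _).2]

theorem crossTest_symm {V : Type} [DecidableEq V] (χ : V → V → V → Bool) (u v x y : V) :
    crossTest χ u v x y = crossTest χ x y u v := by
  rw [Bool.eq_iff_iff, crossTest_eq_true, crossTest_eq_true]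
  tauto

theorem edgeCross_iff_of_map_eq {n : ℕ} [NeZero n] (hn : 3 ≤ n) {ps : List (Fin n × Fin n)}
    (hps : ∀ i j : Fin n, (i, j) ∈ ps ∨ (j, i) ∈ ps ∨ j = i ∨ j = i + 1 ∨ i = j + 1)
    {l : List (ℕ × ℕ)} (hl : ∀ i : Fin n, pairRel l i i = false ∧ pairRel l i (i + 1) = false)
    (A : GeometricRealization (SimpleGraph.cycleGraph n)) {a : Fin n} {b : Bool}
    (h : ps.map (fun p => pairRel l (dihedralEdge a b p.1) (dihedralEdge a b p.2)) =
      ps.map fun p => crossTest (ccw A.pos) p.1 (p.1 + 1) p.2 (p.2 + 1)) (i j : Fin n) :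
    A.EdgeCross i j ↔ pairRel l (dihedralEdge a b i) (dihedralEdge a b j) = true := by
  rw [A.edgeCross_iff_crossTest hn, forall_edges_of_disjointEdges hps
    (f := fun i j => pairRel l (dihedralEdge a b i) (dihedralEdge a b j))
    (g := fun i j => crossTest (ccw A.pos) i (i + 1) j (j + 1))
    (fun i j => pairRel_symm l _ _) (fun i j => crossTest_symm _ _ _ _ _) ?_ ?_ h i j]
  · intro i
    refine ⟨(hl _).1, ?_⟩
    cases b
    · have := (hl (dihedralEdge a false i)).2
      simpa [dihedralEdge, add_assoc] using this
    -- A reflection reverses the order of consecutive edges: the image of `i + 1` comes just before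
    -- the image of `i`.
    · have := (hl (dihedralEdge a true (i + 1))).2
      rw [pairRel_symm]
      convert this using 2
      simp only [dihedralEdge, if_true]
      abel
  · intro i
    simp [crossTest]

theorem crossTest_eq_separated {V R : Type} [DecidableEq V] [CommRing R] [LinearOrder R]
    (p : V → R × R) {u v x y : V} (h₁ : u ≠ x) (h₂ : u ≠ y) (h₃ : v ≠ x) (h₄ : v ≠ y) :
    crossTest (ccw p) u v x y =
      separated (ccw p u v x) (ccw p u v y) (ccw p u x y) (ccw p v x y) := by
  rw [ccw_rotate p u x y |>.symm, ccw_rotate p v x y |>.symm]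
  rw [Bool.eq_iff_iff, crossTest_eq_true]
  simp [separated, h₁, h₂, h₃, h₄]

section Plucker

variable {n : ℕ} {p : Fin n → ℝ × ℝ}

theorem GeneralPosition.affineOk_of_lt (hp : GeneralPosition p) {a b c d : Fin n}
    (h : a < b ∧ b < c ∧ c < d) :
    _root_.affineOk (ccw p b c d) (ccw p a c d) (ccw p a b d) (ccw p a b c) = true := by
  apply hp.affineOk <;> lia

theorem GeneralPosition.pluckerOk_first (hp : GeneralPosition p) {a b c d e : Fin n}
    (h : a < b ∧ b < c ∧ c < d ∧ d < e) :
    _root_.pluckerOk (ccw p a b c) (ccw p a d e) (ccw p a b d) (ccw p a c e) (ccw p a b e)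
      (ccw p a c d) = true := by
  apply hp.pluckerOk <;> lia

/-- The relation with pivot `e`: moving `e` to the front is a cyclic rotation of each triple, so no
sign changes. -/
theorem GeneralPosition.pluckerOk_last (hp : GeneralPosition p) {a b c d e : Fin n}
    (h : a < b ∧ b < c ∧ c < d ∧ d < e) :
    _root_.pluckerOk (ccw p a b e) (ccw p c d e) (ccw p a c e) (ccw p b d e) (ccw p a d e)
      (ccw p b c e) = true := by
  simp only [← ccw_rotate p _ _ e, ← ccw_rotate p _ e]
  apply hp.pluckerOk <;> lia

/-- The relation with pivot `b`. Sorting the triples reverses exactly one factor in each of the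
three products, so all three change sign and the condition is unaffected. -/
theorem GeneralPosition.pluckerOk_second (hp : GeneralPosition p) {a b c d e : Fin n}
    (h : a < b ∧ b < c ∧ c < d ∧ d < e) :
    _root_.pluckerOk (ccw p a b c) (ccw p b d e) (ccw p a b d) (ccw p b c e) (ccw p a b e)
      (ccw p b c d) = true := by
  have h' := hp.pluckerOk (a := b) (b := a) (c := c) (d := d) (e := e) (by lia) (by lia) (by lia)
    (by lia) (by lia) (by lia) (by lia) (by lia) (by lia) (by lia)
  rw [hp.ccw_swap (u := a) (v := b) (w := c) (by lia) (by lia) (by lia),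
    hp.ccw_swap (u := a) (v := b) (w := d) (by lia) (by lia) (by lia),
    hp.ccw_swap (u := a) (v := b) (w := e) (by lia) (by lia) (by lia)] at h'
  simpa [_root_.pluckerOk] using h'

/-- The relation with pivot `d`. Again each product contains exactly one triple of odd order, the
one ending in `e`, and the three sign changes cancel. -/
theorem GeneralPosition.pluckerOk_fourth (hp : GeneralPosition p) {a b c d e : Fin n}
    (h : a < b ∧ b < c ∧ c < d ∧ d < e) :
    _root_.pluckerOk (ccw p a b d) (ccw p c d e) (ccw p a c d) (ccw p b d e) (ccw p a d e)
      (ccw p b c d) = true := by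
  have h' := hp.pluckerOk (a := d) (b := a) (c := b) (d := c) (e := e) (by lia) (by lia) (by lia)
    (by lia) (by lia) (by lia) (by lia) (by lia) (by lia) (by lia)
  rw [hp.ccw_swap (u := c) (v := d) (w := e) (by lia) (by lia) (by lia),
    hp.ccw_swap (u := b) (v := d) (w := e) (by lia) (by lia) (by lia),
    hp.ccw_swap (u := a) (v := d) (w := e) (by lia) (by lia) (by lia),
    ccw_rotate p d a b |>.symm, ccw_rotate p d a c |>.symm, ccw_rotate p d b c |>.symm] at h'
  simpa [_root_.pluckerOk] using h'

end Plucker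

/-- The affine relation excludes exactly the two sign patterns in which both pairs of opposite edges
would cross. -/
theorem exists_map_eq_of_chirotope₄ :
    (forallBool fun x012 => forallBool fun x013 => forallBool fun x023 => forallBool fun x123 =>
      impBool (affineOk x123 x023 x013 x012) <|
    decide (∃ k a b, (disjointEdges₄.map fun p => pairRel (crossings₄ k) (dihedralEdge a b p.1)
      (dihedralEdge a b p.2)) = [separated x012 x013 x023 x123,
        separated x123 x012 x013 x023])) = true := by
  decide +kernel

theorem exists_map_eq_of_chirotope₅ :
    (forallBool fun x012 => forallBool fun x013 => forallBool fun x023 => forallBool fun x123 =>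
      impBool (affineOk x123 x023 x013 x012) <|
    forallBool fun x014 => forallBool fun x024 => forallBool fun x124 =>
      impBool (affineOk x124 x024 x014 x012) <|
    forallBool fun x034 =>
      impBool (pluckerOk x012 x034 x013 x024 x014 x023) <|
    forallBool fun x134 =>
      impBool (affineOk x134 x034 x014 x013) <|
      impBool (pluckerOk x012 x134 x013 x124 x014 x123) <|
    forallBool fun x234 =>
      impBool (affineOk x234 x034 x024 x023) <|
      impBool (affineOk x234 x134 x124 x123) <|
      impBool (pluckerOk x013 x234 x023 x134 x034 x123) <|
      impBool (pluckerOk x014 x234 x024 x134 x034 x124) <|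
    decide (∃ k a b, (disjointEdges₅.map fun p => pairRel (crossings₅ k) (dihedralEdge a b p.1)
      (dihedralEdge a b p.2)) = [separated x012 x013 x023 x123,
        separated x013 x014 x034 x134,
        separated x123 x124 x134 x234,
        separated x124 x012 x014 x024,
        separated x234 x023 x024 x034])) = true := by
  decide +kernel

/-- A search over the 20 triple orientations of six points. Each relation is imposed as soon as its
last triple is fixed: a violated `impBool` premise is true without evaluating its conclusion, so the
whole branch is cut off. A surviving pattern costs one bit test instead of a search over classes and
symmetries. -/
theorem testBit_of_chirotope₆ :
    (forallBool fun x012 => forallBool fun x013 => forallBool fun x023 => forallBool fun x123 =>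
      impBool (affineOk x123 x023 x013 x012) <|
    forallBool fun x014 => forallBool fun x024 => forallBool fun x124 =>
      impBool (affineOk x124 x024 x014 x012) <|
    forallBool fun x034 =>
      impBool (pluckerOk x012 x034 x013 x024 x014 x023) <|
    forallBool fun x134 =>
      impBool (affineOk x134 x034 x014 x013) <|
      impBool (pluckerOk x012 x134 x013 x124 x014 x123) <|
    forallBool fun x234 =>
      impBool (affineOk x234 x034 x024 x023) <|
      impBool (affineOk x234 x134 x124 x123) <|
      impBool (pluckerOk x013 x234 x023 x134 x034 x123) <|
      impBool (pluckerOk x014 x234 x024 x134 x034 x124) <|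
    forallBool fun x015 => forallBool fun x025 => forallBool fun x125 =>
      impBool (affineOk x125 x025 x015 x012) <|
    forallBool fun x035 =>
      impBool (pluckerOk x012 x035 x013 x025 x015 x023) <|
    forallBool fun x135 =>
      impBool (affineOk x135 x035 x015 x013) <|
      impBool (pluckerOk x012 x135 x013 x125 x015 x123) <|
    forallBool fun x235 =>
      impBool (affineOk x235 x035 x025 x023) <|
      impBool (affineOk x235 x135 x125 x123) <|
      impBool (pluckerOk x013 x235 x023 x135 x035 x123) <|
      impBool (pluckerOk x015 x235 x025 x135 x035 x125) <|
    forallBool fun x045 =>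
      impBool (pluckerOk x012 x045 x014 x025 x015 x024) <|
      impBool (pluckerOk x013 x045 x014 x035 x015 x034) <|
      impBool (pluckerOk x023 x045 x024 x035 x025 x034) <|
    forallBool fun x145 =>
      impBool (affineOk x145 x045 x015 x014) <|
      impBool (pluckerOk x012 x145 x014 x125 x015 x124) <|
      impBool (pluckerOk x013 x145 x014 x135 x015 x134) <|
      impBool (pluckerOk x123 x145 x124 x135 x125 x134) <|
    forallBool fun x245 =>
      impBool (affineOk x245 x045 x025 x024) <|
      impBool (affineOk x245 x145 x125 x124) <|
      impBool (pluckerOk x014 x245 x024 x145 x045 x124) <|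
      impBool (pluckerOk x015 x245 x025 x145 x045 x125) <|
      impBool (pluckerOk x023 x245 x024 x235 x025 x234) <|
      impBool (pluckerOk x123 x245 x124 x235 x125 x234) <|
    forallBool fun x345 =>
      impBool (affineOk x345 x045 x035 x034) <|
      impBool (affineOk x345 x145 x135 x134) <|
      impBool (affineOk x345 x245 x235 x234) <|
      impBool (pluckerOk x014 x345 x034 x145 x045 x134) <|
      impBool (pluckerOk x015 x345 x035 x145 x045 x135) <|
      impBool (pluckerOk x024 x345 x034 x245 x045 x234) <|
      impBool (pluckerOk x025 x345 x035 x245 x045 x235) <|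
      impBool (pluckerOk x124 x345 x134 x245 x145 x234) <|
      impBool (pluckerOk x125 x345 x135 x245 x145 x235) <|
    crossingMasks₆.testBit (bitMask [separated x012 x013 x023 x123,
        separated x013 x014 x034 x134,
        separated x014 x015 x045 x145,
        separated x123 x124 x134 x234,
        separated x124 x125 x145 x245,
        separated x125 x012 x015 x025,
        separated x234 x235 x245 x345,
        separated x235 x023 x025 x035,
        separated x345 x034 x035 x045])) = true := by
  decide +kernel

/-- The classes and symmetries are searched here, once for each of the 512 possible crossing sets
rather than for each sign pattern. The equation of cardinalities only speeds up the decision: it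
rejects most labels before any symmetry is tried. -/
theorem exists_map_eq_of_testBit₆ : ∀ c₁ c₂ c₃ c₄ c₅ c₆ c₇ c₈ c₉ : Bool,
    crossingMasks₆.testBit (bitMask [c₁, c₂, c₃, c₄, c₅, c₆, c₇, c₈, c₉]) = true →
    ∃ k, (crossings₆ k).length = [c₁, c₂, c₃, c₄, c₅, c₆, c₇, c₈, c₉].count true ∧
      ∃ a b, (disjointEdges₆.map fun p => pairRel (crossings₆ k) (dihedralEdge a b p.1)
        (dihedralEdge a b p.2)) = [c₁, c₂, c₃, c₄, c₅, c₆, c₇, c₈, c₉] := by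
  decide +kernel

/-- The Boolean statement is specialized to the actual orientations of `A`, whose general position
supplies every premise. -/
theorem exhaustive₄ (A : GeometricRealization (SimpleGraph.cycleGraph 4)) : ∃ k a b,
    ∀ i j, A.EdgeCross i j ↔
      pairRel (crossings₄ k) (dihedralEdge a b i) (dihedralEdge a b j) = true := by
  have hp := A.generalPosition
  have h := exists_map_eq_of_chirotope₄
  replace h := apply_of_forallBool h (ccw A.pos 0 1 2)
  replace h := apply_of_forallBool h (ccw A.pos 0 1 3)
  replace h := apply_of_forallBool h (ccw A.pos 0 2 3)
  replace h := apply_of_forallBool h (ccw A.pos 1 2 3)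
  replace h := of_impBool h (hp.affineOk_of_lt (a := 0) (b := 1) (c := 2) (d := 3)
    (by decide))
  obtain ⟨k, a, b, h⟩ := of_decide_eq_true h
  refine ⟨k, a, b, edgeCross_iff_of_map_eq (by decide) (ps := disjointEdges₄) (by decide)
    (by clear h; revert k; decide +kernel) A (h.trans ?_)⟩
  change _ = [crossTest (ccw A.pos) 0 1 2 3,
    crossTest (ccw A.pos) 1 2 3 0]
  rw [crossTest_eq_separated A.pos (u := 0) (v := 1) (x := 2) (y := 3) (by decide)
    (by decide) (by decide) (by decide)]
  rw [crossTest_eq_separated A.pos (u := 1) (v := 2) (x := 3) (y := 0) (by decide)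
    (by decide) (by decide) (by decide)]
  -- The edges that wrap around produce triples with vertex 0 last; rotation restores increasing
  -- order.
  simp only [ccw_rotate A.pos 0 1 2,
    ccw_rotate A.pos 0 1 3,
    ccw_rotate A.pos 0 2 3]

theorem exhaustive₅ (A : GeometricRealization (SimpleGraph.cycleGraph 5)) : ∃ k a b,
    ∀ i j, A.EdgeCross i j ↔
      pairRel (crossings₅ k) (dihedralEdge a b i) (dihedralEdge a b j) = true := by
  have hp := A.generalPosition
  have h := exists_map_eq_of_chirotope₅
  replace h := apply_of_forallBool h (ccw A.pos 0 1 2)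
  replace h := apply_of_forallBool h (ccw A.pos 0 1 3)
  replace h := apply_of_forallBool h (ccw A.pos 0 2 3)
  replace h := apply_of_forallBool h (ccw A.pos 1 2 3)
  replace h := of_impBool h (hp.affineOk_of_lt (a := 0) (b := 1) (c := 2) (d := 3)
    (by decide))
  replace h := apply_of_forallBool h (ccw A.pos 0 1 4)
  replace h := apply_of_forallBool h (ccw A.pos 0 2 4)
  replace h := apply_of_forallBool h (ccw A.pos 1 2 4)
  replace h := of_impBool h (hp.affineOk_of_lt (a := 0) (b := 1) (c := 2) (d := 4)
    (by decide))
  replace h := apply_of_forallBool h (ccw A.pos 0 3 4)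
  replace h := of_impBool h (hp.pluckerOk_first (a := 0) (b := 1) (c := 2) (d := 3) (e := 4)
    (by decide))
  replace h := apply_of_forallBool h (ccw A.pos 1 3 4)
  replace h := of_impBool h (hp.affineOk_of_lt (a := 0) (b := 1) (c := 3) (d := 4)
    (by decide))
  replace h := of_impBool h (hp.pluckerOk_second (a := 0) (b := 1) (c := 2) (d := 3) (e := 4)
    (by decide))
  replace h := apply_of_forallBool h (ccw A.pos 2 3 4)
  replace h := of_impBool h (hp.affineOk_of_lt (a := 0) (b := 2) (c := 3) (d := 4)
    (by decide))
  replace h := of_impBool h (hp.affineOk_of_lt (a := 1) (b := 2) (c := 3) (d := 4)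
    (by decide))
  replace h := of_impBool h (hp.pluckerOk_fourth (a := 0) (b := 1) (c := 2) (d := 3) (e := 4)
    (by decide))
  replace h := of_impBool h (hp.pluckerOk_last (a := 0) (b := 1) (c := 2) (d := 3) (e := 4)
    (by decide))
  obtain ⟨k, a, b, h⟩ := of_decide_eq_true h
  refine ⟨k, a, b, edgeCross_iff_of_map_eq (by decide) (ps := disjointEdges₅) (by decide)
    (by clear h; revert k; decide +kernel) A (h.trans ?_)⟩
  change _ = [crossTest (ccw A.pos) 0 1 2 3,
    crossTest (ccw A.pos) 0 1 3 4,
    crossTest (ccw A.pos) 1 2 3 4,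
    crossTest (ccw A.pos) 1 2 4 0,
    crossTest (ccw A.pos) 2 3 4 0]
  rw [crossTest_eq_separated A.pos (u := 0) (v := 1) (x := 2) (y := 3) (by decide)
    (by decide) (by decide) (by decide)]
  rw [crossTest_eq_separated A.pos (u := 0) (v := 1) (x := 3) (y := 4) (by decide)
    (by decide) (by decide) (by decide)]
  rw [crossTest_eq_separated A.pos (u := 1) (v := 2) (x := 3) (y := 4) (by decide)
    (by decide) (by decide) (by decide)]
  rw [crossTest_eq_separated A.pos (u := 1) (v := 2) (x := 4) (y := 0) (by decide)
    (by decide) (by decide) (by decide)]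
  rw [crossTest_eq_separated A.pos (u := 2) (v := 3) (x := 4) (y := 0) (by decide)
    (by decide) (by decide) (by decide)]
  simp only [ccw_rotate A.pos 0 1 2,
    ccw_rotate A.pos 0 1 4,
    ccw_rotate A.pos 0 2 4,
    ccw_rotate A.pos 0 2 3,
    ccw_rotate A.pos 0 3 4]

theorem exhaustive₆ (A : GeometricRealization (SimpleGraph.cycleGraph 6)) : ∃ k a b,
    ∀ i j, A.EdgeCross i j ↔
      pairRel (crossings₆ k) (dihedralEdge a b i) (dihedralEdge a b j) = true := by
  have hp := A.generalPosition
  have h := testBit_of_chirotope₆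
  replace h := apply_of_forallBool h (ccw A.pos 0 1 2)
  replace h := apply_of_forallBool h (ccw A.pos 0 1 3)
  replace h := apply_of_forallBool h (ccw A.pos 0 2 3)
  replace h := apply_of_forallBool h (ccw A.pos 1 2 3)
  replace h := of_impBool h (hp.affineOk_of_lt (a := 0) (b := 1) (c := 2) (d := 3)
    (by decide))
  replace h := apply_of_forallBool h (ccw A.pos 0 1 4)
  replace h := apply_of_forallBool h (ccw A.pos 0 2 4)
  replace h := apply_of_forallBool h (ccw A.pos 1 2 4)
  replace h := of_impBool h (hp.affineOk_of_lt (a := 0) (b := 1) (c := 2) (d := 4)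
    (by decide))
  replace h := apply_of_forallBool h (ccw A.pos 0 3 4)
  replace h := of_impBool h (hp.pluckerOk_first (a := 0) (b := 1) (c := 2) (d := 3) (e := 4)
    (by decide))
  replace h := apply_of_forallBool h (ccw A.pos 1 3 4)
  replace h := of_impBool h (hp.affineOk_of_lt (a := 0) (b := 1) (c := 3) (d := 4)
    (by decide))
  replace h := of_impBool h (hp.pluckerOk_second (a := 0) (b := 1) (c := 2) (d := 3) (e := 4)
    (by decide))
  replace h := apply_of_forallBool h (ccw A.pos 2 3 4)
  replace h := of_impBool h (hp.affineOk_of_lt (a := 0) (b := 2) (c := 3) (d := 4)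
    (by decide))
  replace h := of_impBool h (hp.affineOk_of_lt (a := 1) (b := 2) (c := 3) (d := 4)
    (by decide))
  replace h := of_impBool h (hp.pluckerOk_fourth (a := 0) (b := 1) (c := 2) (d := 3) (e := 4)
    (by decide))
  replace h := of_impBool h (hp.pluckerOk_last (a := 0) (b := 1) (c := 2) (d := 3) (e := 4)
    (by decide))
  replace h := apply_of_forallBool h (ccw A.pos 0 1 5)
  replace h := apply_of_forallBool h (ccw A.pos 0 2 5)
  replace h := apply_of_forallBool h (ccw A.pos 1 2 5)
  replace h := of_impBool h (hp.affineOk_of_lt (a := 0) (b := 1) (c := 2) (d := 5)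
    (by decide))
  replace h := apply_of_forallBool h (ccw A.pos 0 3 5)
  replace h := of_impBool h (hp.pluckerOk_first (a := 0) (b := 1) (c := 2) (d := 3) (e := 5)
    (by decide))
  replace h := apply_of_forallBool h (ccw A.pos 1 3 5)
  replace h := of_impBool h (hp.affineOk_of_lt (a := 0) (b := 1) (c := 3) (d := 5)
    (by decide))
  replace h := of_impBool h (hp.pluckerOk_second (a := 0) (b := 1) (c := 2) (d := 3) (e := 5)
    (by decide))
  replace h := apply_of_forallBool h (ccw A.pos 2 3 5)
  replace h := of_impBool h (hp.affineOk_of_lt (a := 0) (b := 2) (c := 3) (d := 5)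
    (by decide))
  replace h := of_impBool h (hp.affineOk_of_lt (a := 1) (b := 2) (c := 3) (d := 5)
    (by decide))
  replace h := of_impBool h (hp.pluckerOk_fourth (a := 0) (b := 1) (c := 2) (d := 3) (e := 5)
    (by decide))
  replace h := of_impBool h (hp.pluckerOk_last (a := 0) (b := 1) (c := 2) (d := 3) (e := 5)
    (by decide))
  replace h := apply_of_forallBool h (ccw A.pos 0 4 5)
  replace h := of_impBool h (hp.pluckerOk_first (a := 0) (b := 1) (c := 2) (d := 4) (e := 5)
    (by decide))
  replace h := of_impBool h (hp.pluckerOk_first (a := 0) (b := 1) (c := 3) (d := 4) (e := 5)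
    (by decide))
  replace h := of_impBool h (hp.pluckerOk_first (a := 0) (b := 2) (c := 3) (d := 4) (e := 5)
    (by decide))
  replace h := apply_of_forallBool h (ccw A.pos 1 4 5)
  replace h := of_impBool h (hp.affineOk_of_lt (a := 0) (b := 1) (c := 4) (d := 5)
    (by decide))
  replace h := of_impBool h (hp.pluckerOk_second (a := 0) (b := 1) (c := 2) (d := 4) (e := 5)
    (by decide))
  replace h := of_impBool h (hp.pluckerOk_second (a := 0) (b := 1) (c := 3) (d := 4) (e := 5)
    (by decide))
  replace h := of_impBool h (hp.pluckerOk_first (a := 1) (b := 2) (c := 3) (d := 4) (e := 5)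
    (by decide))
  replace h := apply_of_forallBool h (ccw A.pos 2 4 5)
  replace h := of_impBool h (hp.affineOk_of_lt (a := 0) (b := 2) (c := 4) (d := 5)
    (by decide))
  replace h := of_impBool h (hp.affineOk_of_lt (a := 1) (b := 2) (c := 4) (d := 5)
    (by decide))
  replace h := of_impBool h (hp.pluckerOk_fourth (a := 0) (b := 1) (c := 2) (d := 4) (e := 5)
    (by decide))
  replace h := of_impBool h (hp.pluckerOk_last (a := 0) (b := 1) (c := 2) (d := 4) (e := 5)
    (by decide))
  replace h := of_impBool h (hp.pluckerOk_second (a := 0) (b := 2) (c := 3) (d := 4) (e := 5)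
    (by decide))
  replace h := of_impBool h (hp.pluckerOk_second (a := 1) (b := 2) (c := 3) (d := 4) (e := 5)
    (by decide))
  replace h := apply_of_forallBool h (ccw A.pos 3 4 5)
  replace h := of_impBool h (hp.affineOk_of_lt (a := 0) (b := 3) (c := 4) (d := 5)
    (by decide))
  replace h := of_impBool h (hp.affineOk_of_lt (a := 1) (b := 3) (c := 4) (d := 5)
    (by decide))
  replace h := of_impBool h (hp.affineOk_of_lt (a := 2) (b := 3) (c := 4) (d := 5)
    (by decide))
  replace h := of_impBool h (hp.pluckerOk_fourth (a := 0) (b := 1) (c := 3) (d := 4) (e := 5)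
    (by decide))
  replace h := of_impBool h (hp.pluckerOk_last (a := 0) (b := 1) (c := 3) (d := 4) (e := 5)
    (by decide))
  replace h := of_impBool h (hp.pluckerOk_fourth (a := 0) (b := 2) (c := 3) (d := 4) (e := 5)
    (by decide))
  replace h := of_impBool h (hp.pluckerOk_last (a := 0) (b := 2) (c := 3) (d := 4) (e := 5)
    (by decide))
  replace h := of_impBool h (hp.pluckerOk_fourth (a := 1) (b := 2) (c := 3) (d := 4) (e := 5)
    (by decide))
  replace h := of_impBool h (hp.pluckerOk_last (a := 1) (b := 2) (c := 3) (d := 4) (e := 5)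
    (by decide))
  obtain ⟨k, -, a, b, h⟩ := exists_map_eq_of_testBit₆ _ _ _ _ _ _ _ _ _ h
  refine ⟨k, a, b, edgeCross_iff_of_map_eq (by decide) (ps := disjointEdges₆) (by decide)
    (by clear h; revert k; decide +kernel) A (h.trans ?_)⟩
  change _ = [crossTest (ccw A.pos) 0 1 2 3,
    crossTest (ccw A.pos) 0 1 3 4,
    crossTest (ccw A.pos) 0 1 4 5,
    crossTest (ccw A.pos) 1 2 3 4,
    crossTest (ccw A.pos) 1 2 4 5,
    crossTest (ccw A.pos) 1 2 5 0,
    crossTest (ccw A.pos) 2 3 4 5,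
    crossTest (ccw A.pos) 2 3 5 0,
    crossTest (ccw A.pos) 3 4 5 0]
  rw [crossTest_eq_separated A.pos (u := 0) (v := 1) (x := 2) (y := 3) (by decide)
    (by decide) (by decide) (by decide)]
  rw [crossTest_eq_separated A.pos (u := 0) (v := 1) (x := 3) (y := 4) (by decide)
    (by decide) (by decide) (by decide)]
  rw [crossTest_eq_separated A.pos (u := 0) (v := 1) (x := 4) (y := 5) (by decide)
    (by decide) (by decide) (by decide)]
  rw [crossTest_eq_separated A.pos (u := 1) (v := 2) (x := 3) (y := 4) (by decide)
    (by decide) (by decide) (by decide)]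
  rw [crossTest_eq_separated A.pos (u := 1) (v := 2) (x := 4) (y := 5) (by decide)
    (by decide) (by decide) (by decide)]
  rw [crossTest_eq_separated A.pos (u := 1) (v := 2) (x := 5) (y := 0) (by decide)
    (by decide) (by decide) (by decide)]
  rw [crossTest_eq_separated A.pos (u := 2) (v := 3) (x := 4) (y := 5) (by decide)
    (by decide) (by decide) (by decide)]
  rw [crossTest_eq_separated A.pos (u := 2) (v := 3) (x := 5) (y := 0) (by decide)
    (by decide) (by decide) (by decide)]
  rw [crossTest_eq_separated A.pos (u := 3) (v := 4) (x := 5) (y := 0) (by decide)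
    (by decide) (by decide) (by decide)]
  simp only [ccw_rotate A.pos 0 1 2,
    ccw_rotate A.pos 0 1 5,
    ccw_rotate A.pos 0 2 5,
    ccw_rotate A.pos 0 2 3,
    ccw_rotate A.pos 0 3 5,
    ccw_rotate A.pos 0 3 4,
    ccw_rotate A.pos 0 4 5]

/-! ### Checking the lists and assembling the theorem -/

theorem realizable_of_isGridDrawing {n : ℕ} [NeZero n] (hn : 3 ≤ n) {p : Fin n → ℤ × ℤ}
    {l : List (ℕ × ℕ)} (h : IsGridDrawing p ∧
      ∀ i j : Fin n, crossTest (ccw p) i (i + 1) j (j + 1) = pairRel l i j) :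
    ∃ A : GeometricRealization (SimpleGraph.cycleGraph n),
      ∀ i j, A.EdgeCross i j ↔ pairRel l i j = true := by
  obtain ⟨A, hA⟩ := h.1.exists_realization hn
  exact ⟨A, fun i j => by rw [hA, h.2]⟩

theorem isGridDrawing_drawing₄ : ∀ k, IsGridDrawing (drawing₄ k) ∧ ∀ i j : Fin 4,
    crossTest (ccw (drawing₄ k)) i (i + 1) j (j + 1) = pairRel (crossings₄ k) i j := by
  decide +kernel

theorem isGridDrawing_drawing₅ : ∀ k, IsGridDrawing (drawing₅ k) ∧ ∀ i j : Fin 5,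
    crossTest (ccw (drawing₅ k)) i (i + 1) j (j + 1) = pairRel (crossings₅ k) i j := by
  decide +kernel

theorem isGridDrawing_drawing₆ : ∀ k, IsGridDrawing (drawing₆ k) ∧ ∀ i j : Fin 6,
    crossTest (ccw (drawing₆ k)) i (i + 1) j (j + 1) = pairRel (crossings₆ k) i j := by
  decide +kernel

theorem embeds₄_iff_le : ∀ k l, Embeds 4 (crossings₄ k) (crossings₄ l) ↔ k ≤ l := by
  decide +kernel

theorem embeds₅_iff_le : ∀ k l, Embeds 5 (crossings₅ k) (crossings₅ l) ↔ k ≤ l := by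
  decide +kernel

theorem eq_of_embeds₆ : ∀ k l, Embeds 6 (crossings₆ k) (crossings₆ l) →
    Embeds 6 (crossings₆ l) (crossings₆ k) → k = l := by
  decide +kernel

/-- Every strict comparison passes through a listed upper cover. Hence the listed relations generate
the order, and no cover is missing from them. -/
theorem embeds₆_iff : ∀ k l, Embeds 6 (crossings₆ k) (crossings₆ l) ↔
    k = l ∨ ∃ m ∈ upperCovers₆ k, Embeds 6 (crossings₆ m) (crossings₆ l) := by
  decide +kernel

theorem ne_of_mem_upperCovers₆ : ∀ k, ∀ l ∈ upperCovers₆ k, k ≠ l := by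
  decide +kernel

/-- Nothing lies strictly between the two ends of a listed relation, so each one is indeed a cover.
-/
theorem eq_or_eq_of_embeds_of_mem_upperCovers₆ : ∀ k, ∀ l ∈ upperCovers₆ k, ∀ m,
    Embeds 6 (crossings₆ k) (crossings₆ m) → Embeds 6 (crossings₆ m) (crossings₆ l) →
      m = k ∨ m = l := by
  decide +kernel

/-- Any two edges of a triangle share a vertex, so no realization has a crossing and all are
isomorphic. -/
theorem geometricPoset_cycleGraph_three :
    ∃ X : GeometricPoset (SimpleGraph.cycleGraph 3), HasCrossings X [] ∧ ∀ Y, Y = X := by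
  have noCross : ∀ (A : GeometricRealization (SimpleGraph.cycleGraph 3)) (i j : Fin 3),
      ¬ A.EdgeCross i j := by
    intro A i j
    have key : ∀ (χ : Fin 3 → Fin 3 → Fin 3 → Bool),
        ∀ i j : Fin 3, crossTest χ i (i + 1) j (j + 1) = false := by
      intro χ i j
      fin_cases i <;> fin_cases j <;> simp [crossTest]
    rw [A.edgeCross_iff_crossTest le_rfl, key]
    exact Bool.false_ne_true
  obtain ⟨A, -⟩ := IsGridDrawing.exists_realization (n := 3) le_rfl
    (p := ![(0, 0), (1, 0), (0, 1)]) (by decide +kernel)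
  refine ⟨A.toClass, ⟨A, rfl, GeometricRealization.crossings_eq_edgePairs le_rfl fun i j => ?_⟩,
    fun Y => ?_⟩
  · simp [noCross A i j, pairRel]
  · induction Y using Quotient.inductionOn with
    | h B =>
      exact Quotient.sound (s := GeometricRealization.setoid _)
        (GeometricRealization.isomorphic_of_edgeCross_iff le_rfl (a := 0) (b := false)
          fun i j => iff_of_false (noCross B _ _) (noCross A _ _))

theorem exists_orderIso_geometricPoset {n m : ℕ} [NeZero n] (hn : 3 ≤ n)
    (c : Fin m → List (ℕ × ℕ))
    (realizable : ∀ k, ∃ A : GeometricRealization (SimpleGraph.cycleGraph n),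
      ∀ i j, A.EdgeCross i j ↔ pairRel (c k) i j = true)
    (exhaustive : ∀ A : GeometricRealization (SimpleGraph.cycleGraph n), ∃ k a b,
      ∀ i j, A.EdgeCross i j ↔ pairRel (c k) (dihedralEdge a b i) (dihedralEdge a b j) = true)
    (hc : ∀ k l, Embeds n (c k) (c l) ↔ k ≤ l) :
    ∃ r : Fin m ≃o GeometricPoset (SimpleGraph.cycleGraph n), ∀ k, HasCrossings (r k) (c k) := by
  obtain ⟨r, hr, hle⟩ := exists_equiv_geometricPoset hn c realizable exhaustive
    fun k l h h' => le_antisymm ((hc k l).1 h) ((hc l k).1 h')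
  exact ⟨⟨r, fun {k l} => (hle k l).trans (hc k l)⟩, hr⟩

theorem mainTheorem5 :
    -- the poset of `C_3` has a single element, the class of the plane realization
    (∃ X : GeometricPoset (SimpleGraph.cycleGraph 3), HasCrossings X [] ∧ ∀ Y, Y = X) ∧
    -- the poset of `C_4` is a chain of two elements, listed in increasing order
    (∃ r : Fin 2 ≃o GeometricPoset (SimpleGraph.cycleGraph 4),
      ∀ i, HasCrossings (r i) (crossings₄ i)) ∧
    -- the poset of `C_5` is a chain of five elements, listed in increasing order
    (∃ r : Fin 5 ≃o GeometricPoset (SimpleGraph.cycleGraph 5),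
      ∀ i, HasCrossings (r i) (crossings₅ i)) ∧
    -- the poset of `C_6` has the twenty-six listed elements, and the given Hasse diagram
    Nat.card (GeometricPoset (SimpleGraph.cycleGraph 6)) = 26 ∧
    (∃ r : Label₆ ≃ GeometricPoset (SimpleGraph.cycleGraph 6),
      (∀ a, HasCrossings (r a) (crossings₆ a)) ∧
      ∀ a b, r a ⋖ r b ↔ b ∈ upperCovers₆ a) := by
  obtain ⟨r, hr, hle⟩ := exists_equiv_geometricPoset (n := 6) (by decide) crossings₆
    (fun k => realizable_of_isGridDrawing (by decide) (isGridDrawing_drawing₆ k)) exhaustive₆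
    eq_of_embeds₆
  refine ⟨geometricPoset_cycleGraph_three,
    exists_orderIso_geometricPoset (by decide) crossings₄
      (fun k => realizable_of_isGridDrawing (by decide) (isGridDrawing_drawing₄ k)) exhaustive₄
      embeds₄_iff_le,
    exists_orderIso_geometricPoset (by decide) crossings₅
      (fun k => realizable_of_isGridDrawing (by decide) (isGridDrawing_drawing₅ k)) exhaustive₅
      embeds₅_iff_le, ?_, r, hr, fun a b => ⟨fun h => ?_, fun h => ?_⟩⟩
  · rw [← Nat.card_congr r, Nat.card_eq_fintype_card]
    rfl
  -- A strict comparison `a < b` goes through some listed `m` with `a < m ≤ b`; if `b` covers `a`,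
  -- then `m = b`.
  · obtain hab | ⟨m, hm, hmb⟩ := (embeds₆_iff a b).1 ((hle a b).1 h.le)
    · exact absurd (congrArg r hab) h.ne
    · have ham : r a < r m := lt_of_le_of_ne
        ((hle a m).2 ((embeds₆_iff a m).2 (Or.inr ⟨m, hm, (embeds₆_iff m m).2 (Or.inl rfl)⟩)))
        fun he => ne_of_mem_upperCovers₆ a m hm (r.injective he)
      obtain hlt | heq := ((hle m b).2 hmb).lt_or_eq
      · exact absurd hlt (h.2 ham)
      · exact r.injective heq ▸ hm
  · refine ⟨lt_of_le_of_ne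
        ((hle a b).2 ((embeds₆_iff a b).2 (Or.inr ⟨b, h, (embeds₆_iff b b).2 (Or.inl rfl)⟩)))
        fun he => ne_of_mem_upperCovers₆ a b h (r.injective he), fun X hX hX' => ?_⟩
    obtain ⟨m, rfl⟩ := r.surjective X
    rcases eq_or_eq_of_embeds_of_mem_upperCovers₆ a b h m ((hle a m).1 hX.le)
      ((hle m b).1 hX'.le) with rfl | rfl
    · exact hX.false
    · exact hX'.false
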